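/- **Setting.** Let $s>1$, $Q=[0,\pi]\times[0,2\pi]$ and $f\in C^2(Q)$, $f=f(x,t)$, with $f(0,t)=f(\pi,t)=0$. Consider real trigonometric polynomials $u(x,t)=\sum_{j\ge1,\,k\in\mathbb Z}\hat u(j,k)\sin(jx)e^{ikt}$, and write $u=w^++w^-+v$, where $w^+$, $w^-$, $v$ collect the modes with $|k|>j$, $|k|<j$, $|k|=j$ respectively. Put $\|w^\pm\|_E^2=\sum\frac{|Q|}{2}|k^2-j^2|\,|\hat w^\pm(j,k)|^2$ and, for $\beta>0$, $\|u\|_{E,\beta}^2=\|w^+\|_E^2+\|w^-\|_E^2+\beta\|v_t\|_{L^2(Q)}^2$. Let $e_1,e_2,\dots$ be an enumeration of all functions $\sin jx\cos kt$, $\sin jx\sin kt$ with $1\le j<k$, ordered so that the eigenvalue $k^2-j^2$ is nondecreasing, and put $$E^{+n}=\mathrm{span}\{e_l:1\le l\le n\},\qquad N^m=\mathrm{span}\{\sin jx\cos jt,\ \sin jx\sin jt:\ 1\le j\le m\},$$ $$E^{-m}=\mathrm{span}\{\sin jx\cos kt,\ \sin jx\sin kt:\ 0\le k<j,\ j+k\le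 m\}.$$ Let $\chi\in C^\infty(\mathbb R)$ with $\chi=1$ on $(-\infty,1]$, $\chi=0$ on $(2,\infty)$, $-2<\chi'<0$ on $(1,2)$, and let $a_6>0$. Define $$I_\beta(u)=\int_Q\Big[\tfrac12(u_t^2-u_x^2-\beta v_t^2)-\tfrac1{s+1}|u|^{s+1}-fu\Big]dx\,dt,\qquad \mathcal I_\beta(u)=2a_6\big(I_\beta(u)^2+1\big),$$ $$\psi(u)=\chi\Big(\mathcal I_\beta(u)^{-1}\int_Q\tfrac{|u|^{s+1}}{s+1}dx\,dt\Big),\qquad J_\beta(u)=\int_Q\Big[\tfrac12(u_t^2-u_x^2-\beta v_t^2)-\tfrac1{s+1}|u|^{s+1}-\psi(u)fu\Big]dx\,dt.$$ Let $(R_n)$ be a sequence of positive reals, independent of $\beta$ and $m$, with $R_{n+1}>4R_n$, and let $n<m$. For a subspace $W$ put $B(R,W)=\{u\in W:\|u\|_{E,\beta}\le R\}$. Write $X=E^{+n}\oplus E^{-m}\oplus N^m$, $F=E^{+m}\oplus E^{-m}\oplus N^m$, and $$D_n^m=B(R_n,X),\qquad U_n^m=\{te_{n+1}+u_n:\ t\in[0,R_{n+1}],\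 u_n\in B(R_{n+1},X),\ \|te_{n+1}+u_n\|_{E,\beta}\le R_{n+1}\}.$$ Let $\Gamma_n^m$ be the set of continuous odd maps $h:D_n^m\to F$ with $h(u)=u$ for $\|u\|_{E,\beta}=R_n$. Let $\Lambda_n^m$ be the set of continuous maps $H:U_n^m\to F$ with $H|_{D_n^m}\in\Gamma_n^m$, and $H(u)=u$ if $\|u\|_{E,\beta}=R_{n+1}$ or $u\in B(R_{n+1},X)\setminus B(R_n,X)$. Define $$b_n^m=\inf_{h\in\Gamma_n^m}\max_{D_n^m}J_\beta\circ h,\qquad c_n^m=\inf_{H\in\Lambda_n^m}\max_{U_n^m}J_\beta\circ H,$$ $$\Lambda_n^m(\delta)=\{H\in\Lambda_n^m:\ J_\beta(H(u))\le b_n^m+\delta\text{ on }D_n^m\},\qquad c_n^m(\delta)=\inf_{H\in\Lambda_n^m(\delta)}\max_{U_n^m}J_\beta\circ H .$$ **Theorem.** There are constants $C(n+1)$, depending only on $n$, $s$, $f$ and the enumeration $(e_l)$ (in particular not on $\beta$ or $m$, nor on $\delta,\chi,a_6,(R_n)$), such that for all $\beta>0$, all $n<m$ and all $0<\delta<c_n^m-b_n^m$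 there is a map $H\in\Lambda_n^m(\delta)$ with $$J_\beta(H(u))\le C(n+1)\qquad\text{for all }u\in U_n^m .$$ Consequently $c_n^m(\delta)\le C(n+1)$. -/

import Mathlib

open Set MeasureTheory

noncomputable section

namespace WaveMinimax

/-- Index of a real Dirichlet-periodic Fourier mode: `sin (j x) cos (k t)` with `j ≥ 1`, `k ≥ 0`
(`isSin = false`), or `sin (j x) sin (k t)` with `j ≥ 1`, `k ≥ 1` (`isSin = true`). -/
@[ext]
structure Mode where
  j : ℕ
  k : ℕ
  isSin : Bool
  one_le_j : 1 ≤ j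
  one_le_k : isSin = true → 1 ≤ k

/-- The function of `(x, t)` with index `i`. -/
def Mode.fn (i : Mode) (x t : ℝ) : ℝ :=
  Real.sin (i.j * x) * (if i.isSin = true then Real.sin (i.k * t) else Real.cos (i.k * t))

/-- `k² - j²`, the eigenvalue of `-(∂ₜ² - ∂ₓ²)` on the mode. -/
def Mode.eigenvalue (i : Mode) : ℤ := (i.k : ℤ) ^ 2 - (i.j : ℤ) ^ 2

/-- The modes of `E⁺`: those with `k > j`, on which `∫ (uₜ² - uₓ²)` is positive. -/
abbrev PosMode : Type := {i : Mode // i.j < i.k}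

/-- Real trigonometric polynomials satisfying the Dirichlet-periodic boundary conditions, given by
their coefficients: `u = ∑ i, u i • Mode.fn i`. All the Galerkin spaces are subspaces. -/
abbrev TrigPoly : Type := Mode →₀ ℝ

/-- Convergence of all coefficients. On every finite-dimensional subspace this is the topology of
any norm; it is only used on the finite-dimensional Galerkin spaces. -/
instance : TopologicalSpace TrigPoly :=
  TopologicalSpace.induced (fun (u : TrigPoly) (i : Mode) => u i) inferInstance

/-- The value `u(x, t)`. -/
def val (u : TrigPoly) (x t : ℝ) : ℝ := u.sum fun i a => a * i.fn x t

/-- The derivative `uₓ(x, t)`. -/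
def dx (u : TrigPoly) (x t : ℝ) : ℝ := deriv (fun y => val u y t) x

/-- The derivative `uₜ(x, t)`. -/
def dt (u : TrigPoly) (x t : ℝ) : ℝ := deriv (fun τ => val u x τ) t

open Classical in
/-- The component `w⁺` of `u` in `E⁺` (modes with `k > j`). -/
def posPart (u : TrigPoly) : TrigPoly := u.filter fun i => i.j < i.k

open Classical in
/-- The component `w⁻` of `u` in `E⁻` (modes with `k < j`). -/
def negPart (u : TrigPoly) : TrigPoly := u.filter fun i => i.k < i.j

open Classical in
/-- The component `v` of `u` in the kernel `N` of `∂ₜ² - ∂ₓ²` (modes with `k = j`). -/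
def kerPart (u : TrigPoly) : TrigPoly := u.filter fun i => i.j = i.k

/-- `Q = [0, π] × [0, 2π]`. -/
def Q : Set (ℝ × ℝ) := Icc 0 Real.pi ×ˢ Icc 0 (2 * Real.pi)

/-- `‖w‖_E² = ∑_{(j,k)} (|Q|/2) |k² - j²| |ŵ(j,k)|²` for `w` in `E⁺ ⊕ E⁻`, where
`w = ∑_{(j,k) ∈ ℕ × ℤ} ŵ(j,k) sin (j x) e^{ikt}` and `|Q|/2 = π²`. A mode with `k ≥ 1` and
coefficient `a` contributes `a²/4` to each of `|ŵ(j,k)|²` and `|ŵ(j,-k)|²`; a mode with `k = 0`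
contributes `a²` to `|ŵ(j,0)|²`. -/
def normSqE (w : TrigPoly) : ℝ :=
  w.sum fun i a =>
    (if i.k = 0 then Real.pi ^ 2 else Real.pi ^ 2 / 2) * |(i.eigenvalue : ℝ)| * a ^ 2

/-- `‖u‖_{E,β} = (‖w⁺‖_E² + ‖w⁻‖_E² + β ‖vₜ‖²_{L²(Q)})^{1/2}`. -/
def normEβ (β : ℝ) (u : TrigPoly) : ℝ :=
  Real.sqrt (normSqE (posPart u) + normSqE (negPart u)
    + β * ∫ p in Q, (dt (kerPart u) p.1 p.2) ^ 2)

/-- `I_β(u) = ∫_Q ½ (uₜ² - uₓ² - β vₜ²) - |u|^{s+1}/(s+1) - f u`. -/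
def functionalI (s : ℝ) (f : ℝ × ℝ → ℝ) (β : ℝ) (u : TrigPoly) : ℝ :=
  ∫ p in Q, (1 / 2 * ((dt u p.1 p.2) ^ 2 - (dx u p.1 p.2) ^ 2 - β * (dt (kerPart u) p.1 p.2) ^ 2)
    - 1 / (s + 1) * |val u p.1 p.2| ^ (s + 1) - f p * val u p.1 p.2)

/-- The smooth cut-off functions `χ`. -/
structure IsCutoff (χ : ℝ → ℝ) : Prop where
  smooth : ContDiff ℝ (⊤ : ℕ∞) χ
  eq_one : ∀ t, t ≤ 1 → χ t = 1
  eq_zero : ∀ t, 2 < t → χ t = 0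
  deriv_mem : ∀ t, 1 < t → t < 2 → -2 < deriv χ t ∧ deriv χ t < 0

/-- `ψ(u) = χ(𝓘_β(u)⁻¹ ∫_Q |u|^{s+1}/(s+1))` with `𝓘_β(u) = 2 a₆ (I_β(u)² + 1)`. -/
def cutoffψ (s : ℝ) (f : ℝ × ℝ → ℝ) (χ : ℝ → ℝ) (a₆ β : ℝ) (u : TrigPoly) : ℝ :=
  χ ((2 * a₆ * ((functionalI s f β u) ^ 2 + 1))⁻¹ *
    ∫ p in Q, |val u p.1 p.2| ^ (s + 1) / (s + 1))

/-- `J_β(u) = ∫_Q ½ (uₜ² - uₓ² - β vₜ²) - |u|^{s+1}/(s+1) - ψ(u) f u`. -/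
def functionalJ (s : ℝ) (f : ℝ × ℝ → ℝ) (χ : ℝ → ℝ) (a₆ β : ℝ) (u : TrigPoly) : ℝ :=
  ∫ p in Q, (1 / 2 * ((dt u p.1 p.2) ^ 2 - (dx u p.1 p.2) ^ 2 - β * (dt (kerPart u) p.1 p.2) ^ 2)
    - 1 / (s + 1) * |val u p.1 p.2| ^ (s + 1)
    - cutoffψ s f χ a₆ β u * f p * val u p.1 p.2)

/-- The eigenfunction `e_{l+1}` as a trigonometric polynomial (the enumeration starts at `0`). -/
def eig (e : ℕ ≃ PosMode) (l : ℕ) : TrigPoly := Finsupp.single (e l).1 1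

/-- `E^{+n} = span {e₁, …, eₙ}`. -/
def Eplus (e : ℕ ≃ PosMode) (n : ℕ) : Submodule ℝ TrigPoly :=
  Submodule.span ℝ {u | ∃ l < n, u = eig e l}

/-- `E^{-m}`, the span of the modes with `k < j` and `j + k ≤ m`. -/
def Eminus (m : ℕ) : Submodule ℝ TrigPoly :=
  Submodule.span ℝ {u | ∃ i : Mode, i.k < i.j ∧ i.j + i.k ≤ m ∧ u = Finsupp.single i 1}

/-- `N^m`, the span of the modes with `j = k ≤ m`. -/
def Nker (m : ℕ) : Submodule ℝ TrigPoly :=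
  Submodule.span ℝ {u | ∃ i : Mode, i.j = i.k ∧ i.j ≤ m ∧ u = Finsupp.single i 1}

/-- `E^{+n} ⊕ E^{-m} ⊕ N^m`. -/
def galerkin (e : ℕ ≃ PosMode) (n m : ℕ) : Submodule ℝ TrigPoly :=
  Eplus e n ⊔ Eminus m ⊔ Nker m

/-- The closed ball `B(r, W)` of radius `r` in a subspace `W` for the norm `‖·‖_{E,β}`. -/
def ball (β r : ℝ) (W : Submodule ℝ TrigPoly) : Set TrigPoly :=
  {u | u ∈ W ∧ normEβ β u ≤ r}

/-- `D_n^m = B(R_n, E^{+n} ⊕ E^{-m} ⊕ N^m)`. -/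
def setD (e : ℕ ≃ PosMode) (R : ℕ → ℝ) (β : ℝ) (n m : ℕ) : Set TrigPoly :=
  ball β (R n) (galerkin e n m)

/-- `Γ_n^m`: continuous odd maps `D_n^m → E^{+m} ⊕ E^{-m} ⊕ N^m` equal to the identity where
`‖u‖_{E,β} = R_n`. Maps are total functions; only their values on `D_n^m` matter. -/
def classΓ (e : ℕ ≃ PosMode) (R : ℕ → ℝ) (β : ℝ) (n m : ℕ) : Set (TrigPoly → TrigPoly) :=
  {h | ContinuousOn h (setD e R β n m) ∧
    MapsTo h (setD e R β n m) (galerkin e m m : Set TrigPoly) ∧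
    (∀ u ∈ setD e R β n m, h (-u) = -h u) ∧
    ∀ u ∈ setD e R β n m, normEβ β u = R n → h u = u}

/-- `U_n^m`, the half ball of vectors `t e_{n+1} + u_n`. -/
def setU (e : ℕ ≃ PosMode) (R : ℕ → ℝ) (β : ℝ) (n m : ℕ) : Set TrigPoly :=
  {u | ∃ t ∈ Icc 0 (R (n + 1)), ∃ uₙ ∈ ball β (R (n + 1)) (galerkin e n m),
    u = t • eig e n + uₙ ∧ normEβ β u ≤ R (n + 1)}

/-- `Λ_n^m`: continuous maps `U_n^m → E^{+m} ⊕ E^{-m} ⊕ N^m` restricting to an element of `Γ_n^m`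
on `D_n^m`, and equal to the identity where `‖u‖_{E,β} = R_{n+1}` and on
`B(R_{n+1}, E^{+n} ⊕ E^{-m} ⊕ N^m) \ B(R_n, E^{+n} ⊕ E^{-m} ⊕ N^m)`. -/
def classΛ (e : ℕ ≃ PosMode) (R : ℕ → ℝ) (β : ℝ) (n m : ℕ) : Set (TrigPoly → TrigPoly) :=
  {H | ContinuousOn H (setU e R β n m) ∧
    MapsTo H (setU e R β n m) (galerkin e m m : Set TrigPoly) ∧
    H ∈ classΓ e R β n m ∧
    (∀ u ∈ setU e R β n m, normEβ β u = R (n + 1) → H u = u) ∧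
    ∀ u ∈ ball β (R (n + 1)) (galerkin e n m) \ ball β (R n) (galerkin e n m), H u = u}

/-- `b_n^m = inf_{h ∈ Γ_n^m} max_{u ∈ D_n^m} J(h(u))`, as an extended real number. -/
def minimaxB (J : TrigPoly → ℝ) (e : ℕ ≃ PosMode) (R : ℕ → ℝ) (β : ℝ) (n m : ℕ) : EReal :=
  ⨅ h ∈ classΓ e R β n m, ⨆ u ∈ setD e R β n m, (J (h u) : EReal)

/-- `Λ_n^m(δ)`: the maps `H ∈ Λ_n^m` with `J(H(u)) ≤ b_n^m + δ` on `D_n^m`. -/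
def classΛδ (J : TrigPoly → ℝ) (e : ℕ ≃ PosMode) (R : ℕ → ℝ) (β : ℝ) (n m : ℕ) (δ : ℝ) :
    Set (TrigPoly → TrigPoly) :=
  {H | H ∈ classΛ e R β n m ∧
    ∀ u ∈ setD e R β n m, (J (H u) : EReal) ≤ minimaxB J e R β n m + (δ : EReal)}

/-- `c_n^m = inf_{H ∈ Λ_n^m} max_{u ∈ U_n^m} J(H(u))`, as an extended real number. -/
def minimaxC (J : TrigPoly → ℝ) (e : ℕ ≃ PosMode) (R : ℕ → ℝ) (β : ℝ) (n m : ℕ) : EReal :=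
  ⨅ H ∈ classΛ e R β n m, ⨆ u ∈ setU e R β n m, (J (H u) : EReal)

/-- `c_n^m(δ) = inf_{H ∈ Λ_n^m(δ)} max_{u ∈ U_n^m} J(H(u))`, as an extended real number. -/
def minimaxCδ (J : TrigPoly → ℝ) (e : ℕ ≃ PosMode) (R : ℕ → ℝ) (β : ℝ) (n m : ℕ) (δ : ℝ) :
    EReal :=
  ⨅ H ∈ classΛδ J e R β n m δ, ⨆ u ∈ setU e R β n m, (J (H u) : EReal)

end WaveMinimax

end

open WaveMinimax

namespace WaveMinimax

/-! ### A deformation lemma for fibrewise concave functions -/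

/-! Write `P` for the span of the modes in `modes e (n + 1) m`, the space containing `U_n^m`. There
`J` is bounded above by a constant `C` depending only on `n`, `s`, `f` and the enumeration: the
quadratic part is positive only on finitely many modes, with eigenvalues bounded independently of
`m`, and `|u|^{s+1}` absorbs them together with the forcing. Testing with the identity gives `c_n^m
≤ C`, so `δ < c_n^m - b_n^m` forces `b_n^m + δ ≤ C`. A nearly optimal `h ∈ Γ_n^m` therefore
satisfies `J ∘ h ≤ C` on `D_n^m`, and it remains to extend `h` to `U_n^m` without losing the bound.
Since `J ≤ C` on all of the linear space `P`, it suffices to deform `h` into `P` below a fixed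
level; inside `P` any interpolation is allowed.

The deformation has two stages. The first replaces the non-concave `J` by an upper bound,
`reducedJ`, which drops the weights of `e₁, …, e_{n+1}` and keeps the fraction `2^{1-s}` of the
superlinear term. Oddness of `h` controls both `J(h u)` and `J(-h u)`, which removes the forcing:
half the quadratic form is at most `powInt + C`. Under this bound, stretching `h u` by a factor up
to `2` where the reduced form is large does not raise `J` above `C` (`functionalJ_smul_le`), and it
brings `reducedJ` below a constant (`exists_stretching`).

The second stage uses that `reducedJ` is concave along translates of `P` and tends to `-∞` there.
Over each `y` in the complementary modes, its high superlevel set in `P` is convex; a centre `c` of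
it is chosen continuously by a partition of unity. As `D_n^m` has dimension one less than `P`, a
small perturbation makes the path avoid the centre, and by concavity pushing radially away from `c`
never climbs. Far out the level is low for every `θ y` with `θ ∈ [0, 1]`, so `y` can be shrunk to
`0` (`exists_deformation_into_factor`).

Finally `exists_extension_classΛ` uses the coefficient of `e_{n+1}` as the time of the deformation.
-/

/-- A continuous map of a compact subset of a finite-dimensional space into a space of larger
dimension can be perturbed to a nowhere vanishing one. -/
theorem exists_nonvanishing_approx {K E P : Type} [TopologicalSpace K]
    [NormedAddCommGroup E] [NormedSpace ℝ E] [FiniteDimensional ℝ E]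
    [NormedAddCommGroup P] [NormedSpace ℝ P] [FiniteDimensional ℝ P] [TietzeExtension.{0} P]
    {ι : K → E} (hι : Topology.IsClosedEmbedding ι)
    (hd : Module.finrank ℝ E < Module.finrank ℝ P) (k : C(K, P)) {ε : ℝ} (hε : 0 < ε) :
    ∃ k' : C(K, P), (∀ x, k' x ≠ 0) ∧ ∀ x, dist (k' x) (k x) < ε := by
  -- Tietze extension to the ambient space, so that smooth approximation applies.
  obtain ⟨g, hg⟩ := ContinuousMap.exists_extension hι k
  obtain ⟨g', hg', hd', -⟩ := g.continuous.exists_contDiff_approx (ε := fun _ => ε / 2) 1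
    continuous_const (fun _ => half_pos hε)
  -- A `C¹` map into a larger dimension misses a dense set; subtracting a small missed value `ζ`
  -- removes all zeros.
  obtain ⟨ζ, hζ, hζ'⟩ :=
    (hg'.dense_compl_range_of_finrank_lt_finrank hd).exists_dist_lt 0 (half_pos hε)
  refine ⟨⟨fun x => g' (ι x) - ζ, by have := hg'.continuous; have := hι.continuous; fun_prop⟩,
    fun x hx => hζ ⟨ι x, sub_eq_zero.1 hx⟩, fun x => ?_⟩
  have h1 : k x = g (ι x) := by rw [← hg]; rfl
  have h2 := hd' (ι x)
  rw [dist_zero_left] at hζ'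
  rw [dist_eq_norm] at h2 ⊢
  calc ‖g' (ι x) - ζ - k x‖ = ‖(g' (ι x) - g (ι x)) - ζ‖ := by rw [h1]; congr 1; abel
    _ ≤ ‖g' (ι x) - g (ι x)‖ + ‖ζ‖ := norm_sub_le _ _
    _ < ε := by linarith

/-- Truncation of a real number to `[0, 1]`. -/
def clamp (r : ℝ) : ℝ := max 0 (min 1 r)

theorem continuous_clamp : Continuous clamp := by unfold clamp; fun_prop

theorem clamp_nonneg (r : ℝ) : 0 ≤ clamp r := le_max_left _ _

theorem clamp_le_one (r : ℝ) : clamp r ≤ 1 := max_le zero_le_one (min_le_left _ _)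

theorem clamp_of_nonpos {r : ℝ} (h : r ≤ 0) : clamp r = 0 :=
  max_eq_left ((min_le_right _ _).trans h)

theorem clamp_of_one_le {r : ℝ} (h : 1 ≤ r) : clamp r = 1 := by
  rw [clamp, min_eq_left h, max_eq_right zero_le_one]

/-- If `E` is concave in the first variable and tends to `-∞` there, a family of points of a
sublevel set, parametrised by a compact set of smaller dimension, can be deformed into the first
factor without raising the level by more than `2`. -/
theorem exists_deformation_into_factor {K P Y : Type} [TopologicalSpace K] [CompactSpace K]
    [T2Space K] [NormedAddCommGroup P] [NormedSpace ℝ P]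
    [NormedAddCommGroup Y] [NormedSpace ℝ Y] {E : P → Y → ℝ}
    (hE : Continuous fun z : P × Y => E z.1 z.2)
    (hconc : ∀ y, ConcaveOn ℝ univ fun p => E p y) (p : C(K, P)) (y : C(K, Y)) {C T : ℝ}
    (hT : ∀ q, T ≤ ‖q‖ → ∀ x, ∀ θ ∈ Icc (0 : ℝ) 1, E q (θ • y x) ≤ C)
    (hC : ∀ x, E (p x) (y x) ≤ C)
    (happrox : ∀ k : C(K, P), ∀ ε > 0,
      ∃ k' : C(K, P), (∀ x, k' x ≠ 0) ∧ ∀ x, dist (k' x) (k x) < ε)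
    (hball : IsCompact (Metric.closedBall (0 : P) T)) :
    ∃ G : ℝ × K → P × Y, Continuous G ∧ (∀ x, ∀ r ≤ 0, G (r, x) = (p x, y x)) ∧
      (∀ x, ∀ r ≥ 1, (G (r, x)).2 = 0) ∧ (∀ z, E (G z).1 (G z).2 ≤ C + 2) ∧
      ∀ x, y x = 0 → ∀ r, (G (r, x)).2 = 0 := by
  -- Either `c x` lies strictly above level `C + 1`, or the whole ball over `y x` is below `C + 2`
  -- and no centre is needed. For each `x` the admissible set is convex (a superlevel set or
  -- everything), and a constant choice works locally. The gap between the two levels makes both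
  -- alternatives open enough for this.
  have hc : ∃ c : C(K, P), ∀ x, c x ∈ {c | C + 1 < E c (y x)} ∪
      {_c | ∀ q ∈ Metric.closedBall (0 : P) T, E q (y x) < C + 2} := by
    refine exists_continuous_forall_mem_convex_of_local_const (fun x => ?_) fun x => ?_
    · by_cases h : ∀ q ∈ Metric.closedBall (0 : P) T, E q (y x) < C + 2
      · have : ({c | C + 1 < E c (y x)} ∪
          {_c | ∀ q ∈ Metric.closedBall (0 : P) T, E q (y x) < C + 2} : Set P) = univ := by
          ext; simp only [mem_union, mem_ofPred_eq, mem_univ, iff_true]; right; simpa using h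
        rw [this]; exact convex_univ
      · have : ({c | C + 1 < E c (y x)} ∪
          {_c | ∀ q ∈ Metric.closedBall (0 : P) T, E q (y x) < C + 2} : Set P) =
            {c ∈ univ | C + 1 < E c (y x)} := by
          ext z
          simp only [mem_union, mem_ofPred_eq, mem_univ, true_and]
          exact ⟨fun h' => h'.resolve_right h, Or.inl⟩
        rw [this]; exact (hconc (y x)).convex_gt _
    · by_cases h : ∃ c, C + 1 < E c (y x)
      · obtain ⟨c, hc⟩ := h
        refine ⟨c, ?_⟩
        have : Continuous fun z => E c (y z) :=
          hE.comp (f := fun z => (c, y z)) (by fun_prop)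
        filter_upwards [this.continuousAt.eventually (lt_mem_nhds hc)] with z hz
        exact Or.inl hz
      · push Not at h
        refine ⟨0, ?_⟩
        have : ∀ᶠ z in nhds x, ∀ q ∈ Metric.closedBall (0 : P) T, E q (y z) < C + 2 := by
          refine hball.eventually_forall_of_forall_eventually fun q _ => ?_
          have : Continuous fun w : K × P => E w.2 (y w.1) :=
            hE.comp (f := fun w : K × P => (w.2, y w.1)) (by fun_prop)
          exact this.continuousAt.eventually (gt_mem_nhds (by linarith [h q]))
        filter_upwards [this] with z hz
        exact Or.inr hz
  obtain ⟨c, hc⟩ := hc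
  -- By compactness of `K`, moves of size less than a uniform `ε` from `p x` raise the level by less
  -- than `1`.
  have hε : ∀ᶠ v in nhds (0 : P), ∀ x ∈ (univ : Set K), E (p x + v) (y x) < C + 1 := by
    refine isCompact_univ.eventually_forall_of_forall_eventually fun x _ => ?_
    have : Continuous fun w : P × K => E (p w.2 + w.1) (y w.2) :=
      hE.comp (f := fun w : P × K => (p w.2 + w.1, y w.2)) (by fun_prop)
    exact this.continuousAt.eventually (gt_mem_nhds (by
      simp only [add_zero]; linarith [hC x]))
  obtain ⟨ε, hε0, hε⟩ := Metric.eventually_nhds_iff.1 hε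
  obtain ⟨k, hk0, hk⟩ := happrox (p - c) ε hε0
  -- `k` is bounded away from `0` on the compact `K`, so one factor `M` pushes every `c x + M • k x`
  -- out of the ball of radius `T`.
  have hM : ∃ M : ℝ, 1 ≤ M ∧ ∀ x, T ≤ ‖c x + M • k x‖ := by
    rcases isEmpty_or_nonempty K with hK | hK
    · exact ⟨1, le_rfl, fun x => isEmptyElim x⟩
    obtain ⟨x₀, -, hx₀⟩ := isCompact_univ.exists_isMinOn univ_nonempty
      (k.continuous.norm.continuousOn)
    obtain ⟨x₁, -, hx₁⟩ := isCompact_univ.exists_isMaxOn univ_nonempty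
      (c.continuous.norm.continuousOn)
    have hpos : 0 < ‖k x₀‖ := norm_pos_iff.2 (hk0 x₀)
    refine ⟨max 1 ((T + ‖c x₁‖) / ‖k x₀‖), le_max_left _ _, fun x => ?_⟩
    set M := max 1 ((T + ‖c x₁‖) / ‖k x₀‖)
    have h1 : T + ‖c x₁‖ ≤ M * ‖k x₀‖ := (div_le_iff₀ hpos).1 (le_max_right _ _)
    have hM0 : 0 ≤ M := zero_le_one.trans (le_max_left _ _)
    have h2 : ‖k x₀‖ ≤ ‖k x‖ := hx₀ (mem_univ x)
    have h3 : ‖c x‖ ≤ ‖c x₁‖ := hx₁ (mem_univ x)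
    have h4 : ‖M • k x‖ ≤ ‖c x + M • k x‖ + ‖c x‖ := by
      have := norm_sub_le (c x + M • k x) (c x)
      rwa [add_sub_cancel_left] at this
    rw [norm_smul, Real.norm_of_nonneg hM0] at h4
    have := mul_le_mul_of_nonneg_left h2 hM0
    linarith
  obtain ⟨M, hM1, hM⟩ := hM
  -- Three consecutive motions, one on each third of `[0, 1]`: from `p` to `c + k`, then along the
  -- ray `c + μ • k` up to `μ = M`, then shrinking `y` to `0`.
  refine ⟨fun z => (c z.2 + (1 + (M - 1) * clamp (3 * z.1 - 1)) •
      (p z.2 + clamp (3 * z.1) • (c z.2 + k z.2 - p z.2) - c z.2),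
      (1 - clamp (3 * z.1 - 2)) • y z.2), ?_, fun x r hr => ?_, fun x r hr => ?_, ?_,
      fun x hx r => ?_⟩
  · have := continuous_clamp
    fun_prop
  · simp only [clamp_of_nonpos (show 3 * r ≤ 0 by linarith),
      clamp_of_nonpos (show 3 * r - 1 ≤ 0 by linarith),
      clamp_of_nonpos (show 3 * r - 2 ≤ 0 by linarith)]
    simp
  · simp only [clamp_of_one_le (show 1 ≤ 3 * r - 2 by linarith)]
    simp
  · rintro ⟨r, x⟩
    dsimp only
    have hEk : ∀ t : ℝ, 0 ≤ t → t ≤ 1 →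
        E (p x + t • (c x + k x - p x)) (y x) < C + 1 := by
      intro t ht0 ht1
      refine hε ?_ x (mem_univ x)
      have h1 := hk x
      rw [dist_zero_right, norm_smul, Real.norm_of_nonneg ht0]
      rw [dist_eq_norm] at h1
      have h2 : ‖c x + k x - p x‖ < ε := by
        have h3 : c x + k x - p x = k x - (p - c) x := by rw [ContinuousMap.sub_apply]; abel
        rwa [h3]
      nlinarith [norm_nonneg (c x + k x - p x)]
    rcases le_total r (1 / 3) with h | h
    · rw [clamp_of_nonpos (show 3 * r - 1 ≤ 0 by linarith),
        clamp_of_nonpos (show 3 * r - 2 ≤ 0 by linarith)]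
      simp only [mul_zero, add_zero, one_smul, sub_zero]
      rw [add_sub_cancel]
      linarith [hEk _ (clamp_nonneg (3 * r)) (clamp_le_one (3 * r))]
    rw [clamp_of_one_le (show 1 ≤ 3 * r by linarith)]
    rw [one_smul]
    have hsimp : p x + (c x + k x - p x) - c x = k x := by abel
    rw [hsimp]
    rcases le_total r (2 / 3) with h' | h'
    · rw [clamp_of_nonpos (show 3 * r - 2 ≤ 0 by linarith)]
      simp only [sub_zero, one_smul]
      set μ := 1 + (M - 1) * clamp (3 * r - 1)
      have hμ : 1 ≤ μ := by
        have := mul_nonneg (sub_nonneg.2 hM1) (clamp_nonneg (3 * r - 1))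
        simp only [μ]; linarith
      rcases hc x with hcx | hcx
      -- `c + k` is a convex combination of `c` and `c + μ • k`. Since `E` exceeds `C + 1` at `c`
      -- but not at `c + k`, concavity keeps it from exceeding `C + 1` at `c + μ • k`.
      · have h1 := hEk 1 zero_le_one le_rfl
        rw [one_smul, add_sub_cancel] at h1
        have h2 : (1 - μ⁻¹) • c x + μ⁻¹ • (c x + μ • k x) = c x + k x := by
          rw [smul_add, smul_smul, inv_mul_cancel₀ (by positivity), one_smul, ← add_assoc,
            ← add_smul]; simp
        have h3 := (hconc (y x)).2 (mem_univ (c x)) (mem_univ (c x + μ • k x))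
          (sub_nonneg.2 (inv_le_one_of_one_le₀ hμ)) (by positivity : 0 ≤ μ⁻¹) (by ring)
        rw [h2] at h3
        simp only [smul_eq_mul, mem_ofPred_eq] at h3 hcx
        by_contra! hcon
        have hi : 0 < μ⁻¹ := by positivity
        nlinarith [inv_le_one_of_one_le₀ hμ]
      · by_cases hb : c x + μ • k x ∈ Metric.closedBall (0 : P) T
        · exact (hcx _ hb).le
        · rw [mem_closedBall_zero_iff, not_le] at hb
          have := hT _ hb.le x 1 ⟨zero_le_one, le_rfl⟩
          rw [one_smul] at this
          linarith
    · rw [clamp_of_one_le (show 1 ≤ 3 * r - 1 by linarith)]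
      simp only [mul_one, add_sub_cancel]
      have := hT _ (hM x) x (1 - clamp (3 * r - 2))
        ⟨by linarith [clamp_le_one (3 * r - 2)], by linarith [clamp_nonneg (3 * r - 2)]⟩
      linarith
  · simp [hx]

/-! ### Orthogonality of the modes -/

theorem integral_cos_int_mul_pi (n : ℤ) :
    ∫ x in (0 : ℝ)..Real.pi, Real.cos (n * x) = if n = 0 then Real.pi else 0 := by
  split_ifs with h
  · simp [h]
  · have h' : (n : ℝ) ≠ 0 := by exact_mod_cast h
    rw [intervalIntegral.integral_comp_mul_left _ h', integral_cos]
    simp [Real.sin_int_mul_pi]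

theorem integral_cos_int_mul_two_pi (n : ℤ) :
    ∫ x in (0 : ℝ)..2 * Real.pi, Real.cos (n * x) = if n = 0 then 2 * Real.pi else 0 := by
  split_ifs with h
  · simp [h]
  · have h' : (n : ℝ) ≠ 0 := by exact_mod_cast h
    rw [intervalIntegral.integral_comp_mul_left _ h', integral_cos]
    have : (n : ℝ) * (2 * Real.pi) = ((2 * n : ℤ) : ℝ) * Real.pi := by push_cast; ring
    rw [this, Real.sin_int_mul_pi]; simp

theorem integral_sin_int_mul_two_pi (n : ℤ) :
    ∫ x in (0 : ℝ)..2 * Real.pi, Real.sin (n * x) = 0 := by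
  by_cases h : n = 0
  · simp [h]
  · have h' : (n : ℝ) ≠ 0 := by exact_mod_cast h
    rw [intervalIntegral.integral_comp_mul_left _ h', integral_sin, Real.cos_int_mul_two_pi]
    simp

theorem integral_sin_mul_sin_pi {j j' : ℕ} (hj : 1 ≤ j) :
    ∫ x in (0 : ℝ)..Real.pi, Real.sin (j * x) * Real.sin (j' * x) =
      if j = j' then Real.pi / 2 else 0 := by
  have h : ∀ x : ℝ, Real.sin (j * x) * Real.sin (j' * x) =
      1 / 2 * (Real.cos (((j - j' : ℤ) : ℝ) * x) - Real.cos (((j + j' : ℤ) : ℝ) * x)) := by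
    intro x; push_cast; rw [sub_mul, add_mul, Real.cos_sub, Real.cos_add]; ring
  simp_rw [h]
  rw [intervalIntegral.integral_const_mul, intervalIntegral.integral_sub
    (Continuous.intervalIntegrable (by fun_prop) _ _)
    (Continuous.intervalIntegrable (by fun_prop) _ _),
    integral_cos_int_mul_pi, integral_cos_int_mul_pi, if_neg (show ¬((j : ℤ) + j' = 0) by omega)]
  by_cases hjj : j = j'
  · rw [if_pos hjj, if_pos (by omega)]; ring
  · rw [if_neg hjj, if_neg (by omega)]; ring

theorem integral_cos_mul_cos_pi {j j' : ℕ} (hj : 1 ≤ j) :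
    ∫ x in (0 : ℝ)..Real.pi, Real.cos (j * x) * Real.cos (j' * x) =
      if j = j' then Real.pi / 2 else 0 := by
  have h : ∀ x : ℝ, Real.cos (j * x) * Real.cos (j' * x) =
      1 / 2 * (Real.cos (((j - j' : ℤ) : ℝ) * x) + Real.cos (((j + j' : ℤ) : ℝ) * x)) := by
    intro x; push_cast; rw [sub_mul, add_mul, Real.cos_sub, Real.cos_add]; ring
  simp_rw [h]
  rw [intervalIntegral.integral_const_mul, intervalIntegral.integral_add
    (Continuous.intervalIntegrable (by fun_prop) _ _)
    (Continuous.intervalIntegrable (by fun_prop) _ _),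
    integral_cos_int_mul_pi, integral_cos_int_mul_pi, if_neg (show ¬((j : ℤ) + j' = 0) by omega)]
  by_cases hjj : j = j'
  · rw [if_pos hjj, if_pos (by omega)]; ring
  · rw [if_neg hjj, if_neg (by omega)]; ring

theorem integral_cos_mul_cos_two_pi (k k' : ℕ) :
    ∫ t in (0 : ℝ)..2 * Real.pi, Real.cos (k * t) * Real.cos (k' * t) =
      if k = k' then (if k = 0 then 2 * Real.pi else Real.pi) else 0 := by
  have h : ∀ x : ℝ, Real.cos (k * x) * Real.cos (k' * x) =
      1 / 2 * (Real.cos (((k - k' : ℤ) : ℝ) * x) + Real.cos (((k + k' : ℤ) : ℝ) * x)) := by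
    intro x; push_cast; rw [sub_mul, add_mul, Real.cos_sub, Real.cos_add]; ring
  simp_rw [h]
  rw [intervalIntegral.integral_const_mul, intervalIntegral.integral_add
    (Continuous.intervalIntegrable (by fun_prop) _ _)
    (Continuous.intervalIntegrable (by fun_prop) _ _),
    integral_cos_int_mul_two_pi, integral_cos_int_mul_two_pi]
  by_cases hkk : k = k'
  · rw [if_pos hkk, if_pos (by omega)]
    by_cases hk : k = 0
    · rw [if_pos hk, if_pos (by omega)]; ring
    · rw [if_neg hk, if_neg (by omega)]; ring
  · rw [if_neg hkk, if_neg (by omega), if_neg (by omega)]; ring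

theorem integral_sin_mul_sin_two_pi {k k' : ℕ} (hk : 1 ≤ k) :
    ∫ t in (0 : ℝ)..2 * Real.pi, Real.sin (k * t) * Real.sin (k' * t) =
      if k = k' then Real.pi else 0 := by
  have h : ∀ x : ℝ, Real.sin (k * x) * Real.sin (k' * x) =
      1 / 2 * (Real.cos (((k - k' : ℤ) : ℝ) * x) - Real.cos (((k + k' : ℤ) : ℝ) * x)) := by
    intro x; push_cast; rw [sub_mul, add_mul, Real.cos_sub, Real.cos_add]; ring
  simp_rw [h]
  rw [intervalIntegral.integral_const_mul, intervalIntegral.integral_sub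
    (Continuous.intervalIntegrable (by fun_prop) _ _)
    (Continuous.intervalIntegrable (by fun_prop) _ _),
    integral_cos_int_mul_two_pi, integral_cos_int_mul_two_pi,
    if_neg (show ¬((k : ℤ) + k' = 0) by omega)]
  by_cases hkk : k = k'
  · rw [if_pos hkk, if_pos (by omega)]; ring
  · rw [if_neg hkk, if_neg (by omega)]; ring

theorem integral_sin_mul_cos_two_pi (k k' : ℕ) :
    ∫ t in (0 : ℝ)..2 * Real.pi, Real.sin (k * t) * Real.cos (k' * t) = 0 := by
  have h : ∀ x : ℝ, Real.sin (k * x) * Real.cos (k' * x) =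
      1 / 2 * (Real.sin (((k - k' : ℤ) : ℝ) * x) + Real.sin (((k + k' : ℤ) : ℝ) * x)) := by
    intro x; push_cast; rw [sub_mul, add_mul, Real.sin_sub, Real.sin_add]; ring
  simp_rw [h]
  rw [intervalIntegral.integral_const_mul, intervalIntegral.integral_add
    (Continuous.intervalIntegrable (by fun_prop) _ _)
    (Continuous.intervalIntegrable (by fun_prop) _ _),
    integral_sin_int_mul_two_pi, integral_sin_int_mul_two_pi]
  simp

theorem setIntegral_Q_mul (F G : ℝ → ℝ) :
    ∫ p in Q, F p.1 * G p.2 =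
      (∫ x in (0 : ℝ)..Real.pi, F x) * ∫ t in (0 : ℝ)..2 * Real.pi, G t := by
  rw [Q, Measure.volume_eq_prod, setIntegral_prod_mul, integral_Icc_eq_integral_Ioc,
    integral_Icc_eq_integral_Ioc, intervalIntegral.integral_of_le Real.pi_pos.le,
    intervalIntegral.integral_of_le (by positivity)]

theorem isCompact_Q : IsCompact Q := isCompact_Icc.prod isCompact_Icc

theorem measurableSet_Q : MeasurableSet Q := measurableSet_Icc.prod measurableSet_Icc

theorem integrableOn_Q {g : ℝ × ℝ → ℝ} (hg : Continuous g) : IntegrableOn g Q :=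
  hg.continuousOn.integrableOn_compact isCompact_Q

/-- The squared `L²(Q)` norm of a mode. -/
noncomputable def Mode.normSq (i : Mode) : ℝ := if i.k = 0 then Real.pi ^ 2 else Real.pi ^ 2 / 2

theorem Mode.normSq_pos (i : Mode) : 0 < i.normSq := by
  unfold Mode.normSq; split_ifs <;> positivity

/-- The `x`-derivative of a mode. -/
noncomputable def Mode.fnDx (i : Mode) (x t : ℝ) : ℝ :=
  i.j * Real.cos (i.j * x) * (if i.isSin = true then Real.sin (i.k * t) else Real.cos (i.k * t))

/-- The `t`-derivative of a mode. -/
noncomputable def Mode.fnDt (i : Mode) (x t : ℝ) : ℝ :=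
  Real.sin (i.j * x) *
    (i.k * (if i.isSin = true then Real.cos (i.k * t) else -Real.sin (i.k * t)))

theorem Mode.continuous_fn (i : Mode) : Continuous fun p : ℝ × ℝ => i.fn p.1 p.2 := by
  unfold Mode.fn; split_ifs <;> fun_prop

theorem Mode.continuous_fnDx (i : Mode) : Continuous fun p : ℝ × ℝ => i.fnDx p.1 p.2 := by
  unfold Mode.fnDx; split_ifs <;> fun_prop

theorem Mode.continuous_fnDt (i : Mode) : Continuous fun p : ℝ × ℝ => i.fnDt p.1 p.2 := by
  unfold Mode.fnDt; split_ifs <;> fun_prop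

theorem Mode.integral_time (i i' : Mode) :
    ∫ t in (0 : ℝ)..2 * Real.pi,
      (if i.isSin = true then Real.sin (i.k * t) else Real.cos (i.k * t)) *
      (if i'.isSin = true then Real.sin (i'.k * t) else Real.cos (i'.k * t)) =
      if i.isSin = i'.isSin ∧ i.k = i'.k then (if i.k = 0 then 2 * Real.pi else Real.pi)
      else 0 := by
  rcases hi : i.isSin with _ | _ <;> rcases hi' : i'.isSin with _ | _
  · simpa using integral_cos_mul_cos_two_pi i.k i'.k
  · simp only [Bool.false_eq_true, if_false, if_true, false_and]
    simp_rw [mul_comm (Real.cos _)]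
    exact integral_sin_mul_cos_two_pi _ _
  · simpa using integral_sin_mul_cos_two_pi i.k i'.k
  · have := i.one_le_k hi
    have h0 : i.k ≠ 0 := by omega
    simpa [h0] using integral_sin_mul_sin_two_pi (k' := i'.k) this

/-- For `k = 0` the factor `k ^ 2` kills both sides, so the exceptional value `2 * π` is harmless.
-/
theorem Mode.integral_time_deriv (i i' : Mode) :
    ∫ t in (0 : ℝ)..2 * Real.pi,
      (i.k * (if i.isSin = true then Real.cos (i.k * t) else -Real.sin (i.k * t))) *
      (i'.k * (if i'.isSin = true then Real.cos (i'.k * t) else -Real.sin (i'.k * t))) =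
      if i.isSin = i'.isSin ∧ i.k = i'.k then
        (if i.k = 0 then 2 * Real.pi else Real.pi) * i.k ^ 2
      else 0 := by
  have hswap : ∀ a b c d : ℝ, (a * b) * (c * d) = (a * c) * (b * d) := fun a b c d => by ring
  simp_rw [hswap (i.k : ℝ)]
  rw [intervalIntegral.integral_const_mul]
  rcases hi : i.isSin with _ | _ <;> rcases hi' : i'.isSin with _ | _
  · simp only [Bool.false_eq_true, if_false, neg_mul_neg, true_and]
    rcases Nat.eq_zero_or_pos i.k with h0 | h0
    · simp [h0]
    · rw [integral_sin_mul_sin_two_pi h0]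
      split_ifs with h1 h2
      · omega
      · rw [← h1]; ring
      · simp
  · simp only [Bool.false_eq_true, if_false, if_true, false_and, neg_mul]
    rw [intervalIntegral.integral_neg, integral_sin_mul_cos_two_pi]; simp
  · simp only [Bool.false_eq_true, if_false, if_true, mul_neg, reduceCtorEq, false_and]
    simp_rw [mul_comm (Real.cos _)]
    rw [intervalIntegral.integral_neg, integral_sin_mul_cos_two_pi]; simp
  · simp only [if_true, true_and]
    rw [integral_cos_mul_cos_two_pi]
    split_ifs with h1 h2
    · rw [← h1]; ring
    · rw [← h1]; ring
    · simp

theorem Mode.eq_iff (i i' : Mode) : i = i' ↔ i.j = i'.j ∧ i.isSin = i'.isSin ∧ i.k = i'.k := by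
  constructor
  · rintro rfl; simp
  · rintro ⟨h1, h2, h3⟩; exact Mode.ext h1 h3 h2

open Classical in
theorem Mode.integral_fn_mul_fn (i i' : Mode) :
    ∫ p in Q, i.fn p.1 p.2 * i'.fn p.1 p.2 = if i = i' then i.normSq else 0 := by
  have h := setIntegral_Q_mul (fun x => Real.sin (i.j * x) * Real.sin (i'.j * x)) (fun t =>
      (if i.isSin = true then Real.sin (i.k * t) else Real.cos (i.k * t)) *
      (if i'.isSin = true then Real.sin (i'.k * t) else Real.cos (i'.k * t)))
  rw [i.integral_time, integral_sin_mul_sin_pi i.one_le_j] at h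
  simp only [Mode.fn]
  simp_rw [mul_mul_mul_comm (Real.sin ((i.j : ℝ) * _))]
  rw [h, Mode.eq_iff, Mode.normSq]
  by_cases h1 : i.j = i'.j <;> by_cases h2 : i.isSin = i'.isSin ∧ i.k = i'.k <;>
    simp only [h1, h2, if_true, if_false, true_and, false_and, and_self, mul_zero, zero_mul] <;>
    split_ifs <;> ring

open Classical in
theorem Mode.integral_fnDx_mul_fnDx (i i' : Mode) :
    ∫ p in Q, i.fnDx p.1 p.2 * i'.fnDx p.1 p.2 =
      if i = i' then i.normSq * i.j ^ 2 else 0 := by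
  have h := setIntegral_Q_mul
    (fun x => i.j * i'.j * (Real.cos (i.j * x) * Real.cos (i'.j * x))) (fun t =>
      (if i.isSin = true then Real.sin (i.k * t) else Real.cos (i.k * t)) *
      (if i'.isSin = true then Real.sin (i'.k * t) else Real.cos (i'.k * t)))
  rw [i.integral_time, intervalIntegral.integral_const_mul,
    integral_cos_mul_cos_pi i.one_le_j] at h
  simp only [Mode.fnDx]
  simp_rw [mul_mul_mul_comm ((i.j : ℝ) * _), mul_mul_mul_comm (i.j : ℝ)]
  rw [h, Mode.eq_iff, Mode.normSq]
  by_cases h1 : i.j = i'.j <;> by_cases h2 : i.isSin = i'.isSin ∧ i.k = i'.k <;>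
    simp only [h1, h2, if_true, if_false, true_and, false_and, and_self, mul_zero, zero_mul] <;>
    split_ifs <;> ring

open Classical in
theorem Mode.integral_fnDt_mul_fnDt (i i' : Mode) :
    ∫ p in Q, i.fnDt p.1 p.2 * i'.fnDt p.1 p.2 =
      if i = i' then i.normSq * i.k ^ 2 else 0 := by
  have h := setIntegral_Q_mul (fun x => Real.sin (i.j * x) * Real.sin (i'.j * x)) (fun t =>
      (i.k * (if i.isSin = true then Real.cos (i.k * t) else -Real.sin (i.k * t))) *
      (i'.k * (if i'.isSin = true then Real.cos (i'.k * t) else -Real.sin (i'.k * t))))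
  rw [i.integral_time_deriv, integral_sin_mul_sin_pi i.one_le_j] at h
  simp only [Mode.fnDt]
  simp_rw [mul_mul_mul_comm (Real.sin ((i.j : ℝ) * _))]
  rw [h, Mode.eq_iff, Mode.normSq]
  by_cases h1 : i.j = i'.j <;> by_cases h2 : i.isSin = i'.isSin ∧ i.k = i'.k <;>
    simp only [h1, h2, if_true, if_false, true_and, false_and, and_self, mul_zero, zero_mul] <;>
    split_ifs <;> ring

open Classical in
/-- Parseval's identity on `Q` for a finite combination of orthogonal functions. -/
theorem setIntegral_Q_sum_sq {g : Mode → ℝ × ℝ → ℝ} (hg : ∀ i, Continuous (g i)) {w : Mode → ℝ}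
    (h : ∀ i i', ∫ p in Q, g i p * g i' p = if i = i' then w i else 0) (u : TrigPoly) :
    ∫ p in Q, (u.sum fun i a => a * g i p) ^ 2 = u.sum fun i a => w i * a ^ 2 := by
  have h1 : ∀ p, (u.sum fun i a => a * g i p) ^ 2 =
      ∑ i ∈ u.support, ∑ i' ∈ u.support, (u i * u i') * (g i p * g i' p) := by
    intro p
    rw [sq, Finsupp.sum, Finset.sum_mul_sum]
    exact Finset.sum_congr rfl fun i _ => Finset.sum_congr rfl fun i' _ => by ring
  simp_rw [h1]
  have hi : ∀ i i', IntegrableOn (fun p => (u i * u i') * (g i p * g i' p)) Q := fun i i' =>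
    integrableOn_Q (((hg i).mul (hg i')).const_mul _)
  rw [integral_finsetSum _ fun i _ => integrable_finsetSum _ fun i' _ => hi i i', Finsupp.sum]
  refine Finset.sum_congr rfl fun i his => ?_
  rw [integral_finsetSum _ fun i' _ => hi i i']
  simp_rw [integral_const_mul, h]
  rw [Finset.sum_eq_single_of_mem i his fun i' _ hne => by rw [if_neg hne.symm, mul_zero],
    if_pos rfl]
  ring

/-! ### Values and derivatives of trigonometric polynomials -/

theorem Mode.hasDerivAt_fn_x (i : Mode) (x t : ℝ) :
    HasDerivAt (fun y => i.fn y t) (i.fnDx x t) x := by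
  have h := ((hasDerivAt_id x).const_mul (i.j : ℝ)).sin.mul_const
    (if i.isSin = true then Real.sin (i.k * t) else Real.cos (i.k * t))
  refine h.congr_deriv ?_
  simp only [Mode.fnDx, id]; ring

theorem Mode.hasDerivAt_fn_t (i : Mode) (x t : ℝ) :
    HasDerivAt (fun τ => i.fn x τ) (i.fnDt x t) t := by
  have h0 := (hasDerivAt_id t).const_mul (i.k : ℝ)
  unfold Mode.fn Mode.fnDt
  split_ifs
  · refine (h0.sin.const_mul (Real.sin (i.j * x))).congr_deriv ?_
    simp only [id]; ring
  · refine (h0.cos.const_mul (Real.sin (i.j * x))).congr_deriv ?_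
    simp only [id]; ring

theorem dx_eq (u : TrigPoly) (x t : ℝ) : dx u x t = u.sum fun i a => a * i.fnDx x t :=
  (HasDerivAt.fun_sum fun i _ => (i.hasDerivAt_fn_x x t).const_mul (u i)).deriv

theorem dt_eq (u : TrigPoly) (x t : ℝ) : dt u x t = u.sum fun i a => a * i.fnDt x t :=
  (HasDerivAt.fun_sum fun i _ => (i.hasDerivAt_fn_t x t).const_mul (u i)).deriv

theorem continuous_val (u : TrigPoly) : Continuous fun p : ℝ × ℝ => val u p.1 p.2 :=
  continuous_finsetSum _ fun i _ => i.continuous_fn.const_mul _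

theorem continuous_dx (u : TrigPoly) : Continuous fun p : ℝ × ℝ => dx u p.1 p.2 := by
  simp_rw [dx_eq]; exact continuous_finsetSum _ fun i _ => i.continuous_fnDx.const_mul _

theorem continuous_dt (u : TrigPoly) : Continuous fun p : ℝ × ℝ => dt u p.1 p.2 := by
  simp_rw [dt_eq]; exact continuous_finsetSum _ fun i _ => i.continuous_fnDt.const_mul _

theorem integral_val_sq (u : TrigPoly) :
    ∫ p in Q, val u p.1 p.2 ^ 2 = u.sum fun i a => i.normSq * a ^ 2 :=
  setIntegral_Q_sum_sq (fun i => i.continuous_fn) Mode.integral_fn_mul_fn u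

theorem integral_dx_sq (u : TrigPoly) :
    ∫ p in Q, dx u p.1 p.2 ^ 2 = u.sum fun i a => i.normSq * i.j ^ 2 * a ^ 2 := by
  simp_rw [dx_eq]
  exact setIntegral_Q_sum_sq (fun i => i.continuous_fnDx) Mode.integral_fnDx_mul_fnDx u

theorem integral_dt_sq (u : TrigPoly) :
    ∫ p in Q, dt u p.1 p.2 ^ 2 = u.sum fun i a => i.normSq * i.k ^ 2 * a ^ 2 := by
  simp_rw [dt_eq]
  exact setIntegral_Q_sum_sq (fun i => i.continuous_fnDt) Mode.integral_fnDt_mul_fnDt u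

/-! ### The topology of `TrigPoly` -/

theorem continuous_trigPoly_iff {α : Type*} [TopologicalSpace α] {g : α → TrigPoly} :
    Continuous g ↔ ∀ i, Continuous fun a => g a i := by
  rw [continuous_induced_rng, continuous_pi_iff]; rfl

theorem continuous_coeff (i : Mode) : Continuous fun u : TrigPoly => u i :=
  continuous_trigPoly_iff.1 continuous_id i

instance : ContinuousAdd TrigPoly where
  continuous_add := continuous_trigPoly_iff.2 fun i =>
    ((continuous_coeff i).comp continuous_fst).add ((continuous_coeff i).comp continuous_snd)

instance : ContinuousNeg TrigPoly where
  continuous_neg := continuous_trigPoly_iff.2 fun i => (continuous_coeff i).neg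

instance : ContinuousSub TrigPoly where
  continuous_sub := continuous_trigPoly_iff.2 fun i =>
    ((continuous_coeff i).comp continuous_fst).sub ((continuous_coeff i).comp continuous_snd)

instance : ContinuousSMul ℝ TrigPoly where
  continuous_smul := continuous_trigPoly_iff.2 fun i =>
    continuous_fst.mul ((continuous_coeff i).comp continuous_snd)

instance : T2Space TrigPoly := by
  refine T2Space.of_injective_continuous (f := fun (u : TrigPoly) (i : Mode) => u i)
    DFunLike.coe_injective continuous_induced_dom

open Classical in
/-- The trigonometric polynomial with given coefficients on the finite set `S`. -/
noncomputable def emb (S : Finset Mode) : (S → ℝ) →ₗ[ℝ] TrigPoly where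
  toFun x := Finsupp.onFinset S (fun i => if h : i ∈ S then x ⟨i, h⟩ else 0) fun i hi => by
    by_contra h; exact hi (dif_neg h)
  map_add' x y := by
    ext i; by_cases h : i ∈ S <;> simp [h]
  map_smul' c x := by
    ext i; by_cases h : i ∈ S <;> simp [h]

open Classical in
theorem emb_apply (S : Finset Mode) (x : S → ℝ) (i : Mode) :
    emb S x i = if h : i ∈ S then x ⟨i, h⟩ else 0 := rfl

theorem emb_apply_of_mem {S : Finset Mode} (x : S → ℝ) {i : Mode} (h : i ∈ S) :
    emb S x i = x ⟨i, h⟩ := by rw [emb_apply, dif_pos h]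

theorem emb_apply_of_notMem {S : Finset Mode} (x : S → ℝ) {i : Mode} (h : i ∉ S) :
    emb S x i = 0 := by rw [emb_apply, dif_neg h]

theorem continuous_emb (S : Finset Mode) : Continuous (emb S) := by
  refine continuous_trigPoly_iff.2 fun i => ?_
  by_cases h : i ∈ S
  · simp_rw [emb_apply_of_mem _ h]; fun_prop
  · simp_rw [emb_apply_of_notMem _ h]; fun_prop

theorem emb_mem_supported (S : Finset Mode) (x : S → ℝ) :
    emb S x ∈ Finsupp.supported ℝ ℝ (S : Set Mode) := by
  rw [Finsupp.mem_supported']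
  intro i hi
  exact emb_apply_of_notMem x hi

/-- The coefficients on `S`. -/
def coeffs (S : Finset Mode) (u : TrigPoly) : S → ℝ := fun i => u i

theorem continuous_coeffs (S : Finset Mode) : Continuous (coeffs S) :=
  continuous_pi fun i => continuous_coeff i

/-- The projection onto the span of the modes in `S`. -/
noncomputable def proj (S : Finset Mode) (u : TrigPoly) : TrigPoly := emb S (coeffs S u)

theorem proj_apply_of_mem {S : Finset Mode} (u : TrigPoly) {i : Mode} (h : i ∈ S) :
    proj S u i = u i := emb_apply_of_mem _ h

theorem proj_apply_of_notMem {S : Finset Mode} (u : TrigPoly) {i : Mode} (h : i ∉ S) :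
    proj S u i = 0 := emb_apply_of_notMem _ h

theorem continuous_proj (S : Finset Mode) : Continuous (proj S) :=
  (continuous_emb S).comp (continuous_coeffs S)

theorem proj_mem_supported (S : Finset Mode) (u : TrigPoly) :
    proj S u ∈ Finsupp.supported ℝ ℝ (S : Set Mode) := emb_mem_supported _ _

theorem proj_of_mem_supported {S : Finset Mode} {u : TrigPoly}
    (hu : u ∈ Finsupp.supported ℝ ℝ (S : Set Mode)) : proj S u = u := by
  ext i
  by_cases h : i ∈ S
  · exact proj_apply_of_mem u h
  · rw [proj_apply_of_notMem u h, (Finsupp.mem_supported' ℝ u).1 hu i h]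

/-! ### Diagonal quadratic forms -/

/-- The diagonal quadratic form with weights `W`. -/
noncomputable def quad (W : Mode → ℝ) (u : TrigPoly) : ℝ := u.sum fun i a => W i * a ^ 2

theorem quad_eq_sum (W : Mode → ℝ) {S : Finset Mode} {u : TrigPoly}
    (hu : u ∈ Finsupp.supported ℝ ℝ (S : Set Mode)) : quad W u = ∑ i ∈ S, W i * u i ^ 2 :=
  Finsupp.sum_of_support_subset _ (by exact_mod_cast (Finsupp.mem_supported ℝ u).1 hu) _
    (by simp)

theorem quad_smul (W : Mode → ℝ) (τ : ℝ) (u : TrigPoly) : quad W (τ • u) = τ ^ 2 * quad W u := by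
  rw [quad, Finsupp.sum_of_support_subset _ (Finsupp.support_smul) _ (by simp), quad,
    Finsupp.sum, Finset.mul_sum]
  exact Finset.sum_congr rfl fun i _ => by simp only [Finsupp.smul_apply, smul_eq_mul]; ring

theorem quad_neg (W : Mode → ℝ) (u : TrigPoly) : quad W (-u) = quad W u := by
  rw [← neg_one_smul ℝ u, quad_smul]; ring

theorem quad_zero (W : Mode → ℝ) : quad W 0 = 0 := Finsupp.sum_zero_index

theorem quad_le_quad {W W' : Mode → ℝ} {u : TrigPoly} (h : ∀ i ∈ u.support, W i ≤ W' i) :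
    quad W u ≤ quad W' u :=
  Finset.sum_le_sum fun i hi => mul_le_mul_of_nonneg_right (h i hi) (sq_nonneg _)

theorem quad_nonneg {W : Mode → ℝ} {u : TrigPoly} (h : ∀ i ∈ u.support, 0 ≤ W i) :
    0 ≤ quad W u :=
  Finset.sum_nonneg fun i hi => mul_nonneg (h i hi) (sq_nonneg _)

theorem quad_nonpos {W : Mode → ℝ} {u : TrigPoly} (h : ∀ i ∈ u.support, W i ≤ 0) :
    quad W u ≤ 0 :=
  Finset.sum_nonpos fun i hi => mul_nonpos_of_nonpos_of_nonneg (h i hi) (sq_nonneg _)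

theorem quad_add_weight (W W' : Mode → ℝ) (c : ℝ) (u : TrigPoly) :
    quad (fun i => W i + c * W' i) u = quad W u + c * quad W' u := by
  simp only [quad, Finsupp.sum, Finset.mul_sum, ← Finset.sum_add_distrib]
  exact Finset.sum_congr rfl fun i _ => by ring

theorem quad_filter (W : Mode → ℝ) (q : Mode → Prop) [DecidablePred q] (u : TrigPoly) :
    quad W (u.filter q) = quad (fun i => if q i then W i else 0) u := by
  rw [quad, Finsupp.sum, Finsupp.support_filter, Finset.sum_filter, quad, Finsupp.sum]
  refine Finset.sum_congr rfl fun i _ => ?_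
  by_cases h : q i <;> simp [h]

theorem quad_emb (W : Mode → ℝ) (S : Finset Mode) (x : S → ℝ) :
    quad W (emb S x) = ∑ i : S, W i * x i ^ 2 := by
  rw [quad_eq_sum W (emb_mem_supported S x), ← Finset.sum_coe_sort]
  exact Finset.sum_congr rfl fun i _ => by rw [emb_apply_of_mem x i.2]

/-! ### The functionals in terms of the coefficients -/

/-- The weights of the quadratic form `∫ uₜ² - uₓ² - β vₜ²`. -/
noncomputable def waveWeight (β : ℝ) (i : Mode) : ℝ :=
  i.normSq * (if i.j = i.k then -(β * i.k ^ 2) else (i.eigenvalue : ℝ))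

theorem waveWeight_pos {β : ℝ} {i : Mode} (h : i.j < i.k) : 0 < waveWeight β i := by
  rw [waveWeight, if_neg h.ne, Mode.eigenvalue]
  refine mul_pos i.normSq_pos ?_
  have : (i.j : ℝ) < i.k := by exact_mod_cast h
  have h0 : (0 : ℝ) ≤ i.j := Nat.cast_nonneg _
  push_cast
  nlinarith

theorem waveWeight_neg {β : ℝ} (hβ : 0 < β) {i : Mode} (h : i.k ≤ i.j) : waveWeight β i < 0 := by
  rw [waveWeight]
  refine mul_neg_of_pos_of_neg i.normSq_pos ?_
  have hj : (1 : ℝ) ≤ i.j := by exact_mod_cast i.one_le_j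
  split_ifs with hjk
  · rw [← hjk]; nlinarith [mul_pos hβ (show (0 : ℝ) < (i.j : ℝ) ^ 2 by positivity)]
  · have : (i.k : ℝ) < i.j := by exact_mod_cast (lt_of_le_of_ne h (Ne.symm hjk))
    have h0 : (0 : ℝ) ≤ i.k := Nat.cast_nonneg _
    rw [Mode.eigenvalue]; push_cast; nlinarith

theorem waveWeight_ne_zero {β : ℝ} (hβ : 0 < β) (i : Mode) : waveWeight β i ≠ 0 := by
  rcases lt_or_ge i.j i.k with h | h
  · exact (waveWeight_pos h).ne'
  · exact (waveWeight_neg hβ h).ne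

theorem normSqE_eq_quad (u : TrigPoly) :
    normSqE u = quad (fun i => i.normSq * |(i.eigenvalue : ℝ)|) u := rfl

/-- All three pieces are diagonal in the modes, and `β > 0` makes `β * k ^ 2` the absolute value of
the kernel weight. The norm thus uses the weights of the wave form up to sign. -/
theorem normEβ_eq {β : ℝ} (hβ : 0 < β) (u : TrigPoly) :
    normEβ β u = Real.sqrt (quad (fun i => |waveWeight β i|) u) := by
  classical
  rw [normEβ, integral_dt_sq]
  change Real.sqrt (_ + _ + β * quad (fun i => i.normSq * i.k ^ 2) (kerPart u)) = _
  rw [normSqE_eq_quad, normSqE_eq_quad, posPart, negPart, kerPart]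
  simp only [quad_filter]
  congr 1
  simp only [quad, Finsupp.sum, Finset.mul_sum, ← Finset.sum_add_distrib]
  refine Finset.sum_congr rfl fun i _ => ?_
  rw [waveWeight, abs_mul, abs_of_pos i.normSq_pos]
  rcases lt_trichotomy i.j i.k with h | h | h
  · simp [h, h.ne, h.not_gt]
  · simp only [h, lt_irrefl, if_true, if_false, abs_neg]
    rw [abs_of_nonneg (by positivity)]; ring
  · simp [h, h.ne', h.not_gt]

/-- The superlinear term `∫ |u|^{s+1} / (s+1)`. -/
noncomputable def powInt (s : ℝ) (u : TrigPoly) : ℝ :=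
  ∫ p in Q, |val u p.1 p.2| ^ (s + 1) / (s + 1)

/-- The forcing term `∫ f u`. -/
noncomputable def forcing (f : ℝ × ℝ → ℝ) (u : TrigPoly) : ℝ := ∫ p in Q, f p * val u p.1 p.2

theorem integrableOn_pow {s : ℝ} (hs : 1 < s) (u : TrigPoly) :
    IntegrableOn (fun p => |val u p.1 p.2| ^ (s + 1) / (s + 1)) Q :=
  integrableOn_Q (((continuous_val u).abs.rpow_const fun _ => Or.inr (by linarith)).div_const _)

theorem integrableOn_forcing {f : ℝ × ℝ → ℝ} (hf : ContinuousOn f Q) (u : TrigPoly) :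
    IntegrableOn (fun p => f p * val u p.1 p.2) Q :=
  (hf.mul (continuous_val u).continuousOn).integrableOn_compact isCompact_Q

/-- By Parseval the form is diagonal. On the modes `j = k` the wave part cancels and only the `β`
term is left. -/
theorem integral_wave (β : ℝ) (u : TrigPoly) :
    ∫ p in Q, 1 / 2 * (dt u p.1 p.2 ^ 2 - dx u p.1 p.2 ^ 2 - β * dt (kerPart u) p.1 p.2 ^ 2) =
      1 / 2 * quad (waveWeight β) u := by
  classical
  rw [integral_const_mul, integral_sub, integral_sub, integral_const_mul, integral_dt_sq,
    integral_dx_sq, integral_dt_sq]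
  · congr 1
    change quad (fun i => i.normSq * i.k ^ 2) u - quad (fun i => i.normSq * i.j ^ 2) u -
      β * quad (fun i => i.normSq * i.k ^ 2) (kerPart u) = _
    rw [kerPart, quad_filter]
    simp only [quad, Finsupp.sum, Finset.mul_sum, ← Finset.sum_sub_distrib]
    refine Finset.sum_congr rfl fun i _ => ?_
    rw [waveWeight, Mode.eigenvalue]
    by_cases h : i.j = i.k
    · simp only [h, if_true]; ring
    · simp only [h, if_false]; push_cast; ring
  · exact integrableOn_Q ((continuous_dt u).pow 2)
  · exact integrableOn_Q ((continuous_dx u).pow 2)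
  · exact integrableOn_Q (((continuous_dt u).pow 2).sub ((continuous_dx u).pow 2))
  · exact integrableOn_Q (((continuous_dt _).pow 2).const_mul β)

theorem integral_functional {s : ℝ} (hs : 1 < s) {f : ℝ × ℝ → ℝ} (hf : ContinuousOn f Q)
    (β c : ℝ) (u : TrigPoly) :
    ∫ p in Q, (1 / 2 * (dt u p.1 p.2 ^ 2 - dx u p.1 p.2 ^ 2 - β * dt (kerPart u) p.1 p.2 ^ 2)
      - 1 / (s + 1) * |val u p.1 p.2| ^ (s + 1) - c * f p * val u p.1 p.2) =
      1 / 2 * quad (waveWeight β) u - powInt s u - c * forcing f u := by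
  have h1 : ∀ p : ℝ × ℝ, 1 / (s + 1) * |val u p.1 p.2| ^ (s + 1) =
    |val u p.1 p.2| ^ (s + 1) / (s + 1) := fun p => by ring
  simp_rw [h1, mul_assoc c]
  have hi : IntegrableOn (fun p : ℝ × ℝ => 1 / 2 * (dt u p.1 p.2 ^ 2 - dx u p.1 p.2 ^ 2 -
      β * dt (kerPart u) p.1 p.2 ^ 2)) Q :=
    integrableOn_Q (((((continuous_dt u).pow 2).sub ((continuous_dx u).pow 2)).sub
      (((continuous_dt _).pow 2).const_mul β)).const_mul _)
  rw [integral_sub (by exact hi.sub (integrableOn_pow hs u))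
      ((integrableOn_forcing hf u).const_mul c),
    integral_sub hi (integrableOn_pow hs u), integral_wave, integral_const_mul]
  rfl

theorem functionalI_eq {s : ℝ} (hs : 1 < s) {f : ℝ × ℝ → ℝ} (hf : ContinuousOn f Q)
    (β : ℝ) (u : TrigPoly) :
    functionalI s f β u = 1 / 2 * quad (waveWeight β) u - powInt s u - forcing f u := by
  have := integral_functional hs hf β 1 u
  simp only [one_mul] at this
  exact this

theorem functionalJ_eq {s : ℝ} (hs : 1 < s) {f : ℝ × ℝ → ℝ} (hf : ContinuousOn f Q)
    (χ : ℝ → ℝ) (a₆ β : ℝ) (u : TrigPoly) :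
    functionalJ s f χ a₆ β u = 1 / 2 * quad (waveWeight β) u - powInt s u -
      cutoffψ s f χ a₆ β u * forcing f u :=
  integral_functional hs hf β _ u

theorem val_add (u v : TrigPoly) (x t : ℝ) : val (u + v) x t = val u x t + val v x t :=
  Finsupp.sum_add_index' (by simp) (by intros; ring)

theorem val_smul (τ : ℝ) (u : TrigPoly) (x t : ℝ) : val (τ • u) x t = τ * val u x t := by
  rw [val, Finsupp.sum_smul_index (by simp), val, Finsupp.mul_sum]
  exact Finset.sum_congr rfl fun i _ => by ring

theorem forcing_smul (f : ℝ × ℝ → ℝ) (τ : ℝ) (u : TrigPoly) :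
    forcing f (τ • u) = τ * forcing f u := by
  simp_rw [forcing, val_smul, mul_left_comm _ τ, integral_const_mul]

theorem forcing_neg (f : ℝ × ℝ → ℝ) (u : TrigPoly) : forcing f (-u) = -forcing f u := by
  rw [← neg_one_smul ℝ u, forcing_smul]; ring

theorem powInt_smul (s : ℝ) {τ : ℝ} (hτ : 0 ≤ τ) (u : TrigPoly) :
    powInt s (τ • u) = τ ^ (s + 1) * powInt s u := by
  simp_rw [powInt, val_smul, abs_mul, abs_of_nonneg hτ, Real.mul_rpow hτ (abs_nonneg _),
    mul_div_assoc, integral_const_mul]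

theorem powInt_neg (s : ℝ) (u : TrigPoly) : powInt s (-u) = powInt s u := by
  have : ∀ x t, val (-u) x t = -val u x t := fun x t => by
    rw [← neg_one_smul ℝ u, val_smul]; ring
  simp_rw [powInt, this, abs_neg]

theorem powInt_nonneg {s : ℝ} (hs : 1 < s) (u : TrigPoly) : 0 ≤ powInt s u :=
  integral_nonneg fun _ => by
    have : 0 < s + 1 := by linarith
    positivity

theorem convexOn_powInt {s : ℝ} (hs : 1 < s) : ConvexOn ℝ univ (powInt s) := by
  refine ⟨convex_univ, fun u _ v _ a b ha hb hab => ?_⟩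
  have hs1 : 0 < s + 1 := by linarith
  simp only [powInt, smul_eq_mul]
  rw [← integral_const_mul, ← integral_const_mul, ← integral_add
    ((integrableOn_pow hs u).const_mul a) ((integrableOn_pow hs v).const_mul b)]
  refine integral_mono (integrableOn_pow hs _)
    (((integrableOn_pow hs u).const_mul a).add ((integrableOn_pow hs v).const_mul b)) fun p => ?_
  simp only [val_add, val_smul]
  have h1 := (convexOn_rpow (show 1 ≤ s + 1 by linarith)).2 (mem_Ici.2 (abs_nonneg (val u p.1 p.2)))
    (mem_Ici.2 (abs_nonneg (val v p.1 p.2))) ha hb hab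
  simp only [smul_eq_mul] at h1
  have h2 : |a * val u p.1 p.2 + b * val v p.1 p.2| ≤
      a * |val u p.1 p.2| + b * |val v p.1 p.2| := by
    refine (abs_add_le _ _).trans_eq ?_
    rw [abs_mul, abs_mul, abs_of_nonneg ha, abs_of_nonneg hb]
  have h3 := Real.rpow_le_rpow (abs_nonneg _) h2 hs1.le
  calc _ ≤ (a * |val u p.1 p.2| ^ (s + 1) + b * |val v p.1 p.2| ^ (s + 1)) / (s + 1) := by
        gcongr; exact h3.trans h1
    _ = _ := by ring

/-- A finite convex function on a finite-dimensional space is continuous, so no estimate of the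
integral is needed. -/
theorem continuous_powInt_comp {s : ℝ} (hs : 1 < s) {V : Type*} [NormedAddCommGroup V]
    [NormedSpace ℝ V] [FiniteDimensional ℝ V] (g : V →ₗ[ℝ] TrigPoly) :
    Continuous fun x => powInt s (g x) := by
  have h : ConvexOn ℝ univ (fun x => powInt s (g x)) := by
    have := (convexOn_powInt hs).comp_linearMap g
    rwa [preimage_univ] at this
  exact continuousOn_univ.1 (h.continuousOn isOpen_univ)

/-! ### The Galerkin spaces as coordinate subspaces -/

/-- The modes spanning `galerkin e n m`. -/
def modeSet (e : ℕ ≃ PosMode) (n m : ℕ) : Set Mode :=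
  {i | (∃ l < n, i = (e l).1) ∨ (i.k < i.j ∧ i.j + i.k ≤ m) ∨ (i.j = i.k ∧ i.j ≤ m)}

theorem finite_modeSet (e : ℕ ≃ PosMode) (n m : ℕ) : (modeSet e n m).Finite := by
  have h1 : ((fun l => (e l).1) '' Iio n).Finite := (finite_Iio n).image _
  have h2 : {i : Mode | i.j ≤ m ∧ i.k ≤ m}.Finite := by
    refine Finite.of_finite_image (f := fun i : Mode => (i.j, i.k, i.isSin)) ?_ ?_
    · refine ((finite_Iic m).prod ((finite_Iic m).prod finite_univ)).subset ?_
      rintro _ ⟨i, hi, rfl⟩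
      exact ⟨hi.1, hi.2, mem_univ _⟩
    · intro i _ i' _ h
      simp only [Prod.mk.injEq] at h
      exact Mode.ext h.1 h.2.1 h.2.2
  refine (h1.union h2).subset ?_
  rintro i (⟨l, hl, rfl⟩ | h | h)
  · exact Or.inl ⟨l, hl, rfl⟩
  · exact Or.inr ⟨by omega, by omega⟩
  · exact Or.inr ⟨by omega, by omega⟩

/-- The modes spanning `galerkin e n m`, as a finite set. -/
noncomputable def modes (e : ℕ ≃ PosMode) (n m : ℕ) : Finset Mode := (finite_modeSet e n m).toFinset

theorem mem_modes {e : ℕ ≃ PosMode} {n m : ℕ} {i : Mode} : i ∈ modes e n m ↔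
    (∃ l < n, i = (e l).1) ∨ (i.k < i.j ∧ i.j + i.k ≤ m) ∨ (i.j = i.k ∧ i.j ≤ m) := by
  rw [modes, Finite.mem_toFinset]; rfl

theorem galerkin_eq (e : ℕ ≃ PosMode) (n m : ℕ) :
    galerkin e n m = Finsupp.supported ℝ ℝ (modes e n m : Set Mode) := by
  rw [galerkin, Eplus, Eminus, Nker, ← Submodule.span_union, ← Submodule.span_union,
    Finsupp.supported_eq_span_single]
  congr 1
  ext u
  simp only [mem_union, mem_ofPred_eq, mem_image, Finset.mem_coe, mem_modes]
  constructor
  · rintro ((⟨l, hl, rfl⟩ | ⟨i, h1, h2, rfl⟩) | ⟨i, h1, h2, rfl⟩)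
    · exact ⟨_, Or.inl ⟨l, hl, rfl⟩, rfl⟩
    · exact ⟨i, Or.inr (Or.inl ⟨h1, h2⟩), rfl⟩
    · exact ⟨i, Or.inr (Or.inr ⟨h1, h2⟩), rfl⟩
  · rintro ⟨i, (⟨l, hl, rfl⟩ | ⟨h1, h2⟩ | ⟨h1, h2⟩), rfl⟩
    · exact Or.inl (Or.inl ⟨l, hl, rfl⟩)
    · exact Or.inl (Or.inr ⟨i, h1, h2, rfl⟩)
    · exact Or.inr ⟨i, h1, h2, rfl⟩

theorem modes_mono {e : ℕ ≃ PosMode} {n n' : ℕ} (h : n ≤ n') (m : ℕ) :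
    modes e n m ⊆ modes e n' m := by
  intro i hi
  rw [mem_modes] at hi ⊢
  rcases hi with ⟨l, hl, rfl⟩ | hi
  · exact Or.inl ⟨l, hl.trans_le h, rfl⟩
  · exact Or.inr hi

theorem notMem_modes (e : ℕ ≃ PosMode) (n m : ℕ) : (e n).1 ∉ modes e n m := by
  have h := (e n).2
  rw [mem_modes]
  rintro (⟨l, hl, h'⟩ | h' | h')
  · exact hl.ne (e.injective (Subtype.ext h')).symm
  · omega
  · omega

theorem mem_modes_succ (e : ℕ ≃ PosMode) (n m : ℕ) : (e n).1 ∈ modes e (n + 1) m :=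
  mem_modes.2 (Or.inl ⟨n, n.lt_succ_self, rfl⟩)

theorem modes_succ [DecidableEq Mode] (e : ℕ ≃ PosMode) (n m : ℕ) :
    modes e (n + 1) m = insert (e n).1 (modes e n m) := by
  ext i
  rw [Finset.mem_insert, mem_modes, mem_modes]
  constructor
  · rintro (⟨l, hl, rfl⟩ | h)
    · rcases Nat.lt_succ_iff_lt_or_eq.1 hl with h | rfl
      · exact Or.inr (Or.inl ⟨l, h, rfl⟩)
      · exact Or.inl rfl
    · exact Or.inr (Or.inr h)
  · rintro (rfl | ⟨l, hl, rfl⟩ | h)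
    · exact Or.inl ⟨n, n.lt_succ_self, rfl⟩
    · exact Or.inl ⟨l, hl.trans n.lt_succ_self, rfl⟩
    · exact Or.inr h

/-! ### Lower order terms -/

/-- Beyond the threshold `V`, which satisfies `ε * V ^ (s - 1) ≥ A + M`, the power dominates; below
it the left side is at most its value at `V`. -/
theorem exists_quadratic_le_rpow {s : ℝ} (hs : 1 < s) {A M ε : ℝ} (hA : 0 ≤ A) (hM : 0 ≤ M)
    (hε : 0 < ε) : ∃ C, 0 ≤ C ∧ ∀ v : ℝ, 0 ≤ v → A * v ^ 2 + M * v ≤ ε * v ^ (s + 1) + C := by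
  set V : ℝ := max 1 (((A + M) / ε) ^ (s - 1)⁻¹)
  have hV : 1 ≤ V := le_max_left _ _
  refine ⟨A * V ^ 2 + M * V, by positivity, fun v hv => ?_⟩
  rcases le_total v V with h | h
  · have : 0 ≤ ε * v ^ (s + 1) := by positivity
    nlinarith [mul_le_mul_of_nonneg_left h hM,
      mul_le_mul_of_nonneg_left (pow_le_pow_left₀ hv h 2) hA]
  · have hv1 : 1 ≤ v := hV.trans h
    have hv0 : 0 < v := by linarith
    have h1 : (A + M) / ε ≤ v ^ (s - 1) := by
      have h2 : ((A + M) / ε) ^ (s - 1)⁻¹ ≤ v := (le_max_right _ _).trans h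
      have h3 := Real.rpow_le_rpow (by positivity) h2 (by linarith : 0 ≤ s - 1)
      rwa [Real.rpow_inv_rpow (by positivity) (by linarith)] at h3
    have h4 : v ^ (s + 1) = v ^ (s - 1) * v ^ 2 := by
      rw [← Real.rpow_natCast v 2, ← Real.rpow_add hv0]; congr 1; push_cast; ring
    have h5 : A + M ≤ ε * v ^ (s - 1) := by
      rw [div_le_iff₀ hε] at h1; linarith
    have h6 : 0 ≤ A * V ^ 2 + M * V := by positivity
    have h7 : M * v ≤ M * v ^ 2 := mul_le_mul_of_nonneg_left (by nlinarith) hM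
    rw [h4]
    nlinarith [mul_le_mul_of_nonneg_right h5 (sq_nonneg v)]

/-- The pointwise inequality of `exists_quadratic_le_rpow` is integrated over `Q`, which has finite
measure. The constant is uniform in `u`; this is the source of the independence of `m` and `β`. -/
theorem exists_lower_order_le {s : ℝ} (hs : 1 < s) {f : ℝ × ℝ → ℝ} (hf : ContinuousOn f Q)
    {A ε : ℝ} (hA : 0 ≤ A) (hε : 0 < ε) :
    ∃ C, 0 ≤ C ∧ ∀ u, A * quad Mode.normSq u + |forcing f u| ≤ ε * powInt s u + C := by
  obtain ⟨M, hM⟩ := isCompact_Q.exists_bound_of_continuousOn hf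
  have hM0 : 0 ≤ max M 0 := le_max_right _ _
  have hs1 : 0 < s + 1 := by linarith
  obtain ⟨C, hC0, hC⟩ := exists_quadratic_le_rpow hs hA hM0 (div_pos hε hs1)
  refine ⟨C * (volume Q).toReal, by positivity, fun u => ?_⟩
  have hq : quad Mode.normSq u = ∫ p in Q, val u p.1 p.2 ^ 2 := (integral_val_sq u).symm
  have hi1 : IntegrableOn (fun p => val u p.1 p.2 ^ 2) Q :=
    integrableOn_Q ((continuous_val u).pow 2)
  have hi2 := (integrableOn_forcing hf u).norm
  have hi3 := integrableOn_pow hs u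
  have hfin : volume Q ≠ ⊤ := isCompact_Q.measure_lt_top.ne
  have hi4 : IntegrableOn (fun _ : ℝ × ℝ => C) Q := integrableOn_const hfin
  calc A * quad Mode.normSq u + |forcing f u|
      ≤ (∫ p in Q, A * val u p.1 p.2 ^ 2) + ∫ p in Q, ‖f p * val u p.1 p.2‖ := by
        rw [hq, integral_const_mul]
        gcongr
        exact norm_integral_le_integral_norm (fun p : ℝ × ℝ => f p * val u p.1 p.2)
    _ = ∫ p in Q, (A * val u p.1 p.2 ^ 2 + ‖f p * val u p.1 p.2‖) :=
        (integral_add (hi1.const_mul A) hi2).symm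
    _ ≤ ∫ p in Q, (ε * (|val u p.1 p.2| ^ (s + 1) / (s + 1)) + C) := by
        refine setIntegral_mono_on ((hi1.const_mul A).add hi2) ((hi3.const_mul ε).add hi4)
          measurableSet_Q fun p hp => ?_
        have h1 := hC |val u p.1 p.2| (abs_nonneg _)
        rw [sq_abs] at h1
        have h2 : ‖f p * val u p.1 p.2‖ ≤ max M 0 * |val u p.1 p.2| := by
          rw [norm_mul]
          exact mul_le_mul_of_nonneg_right ((hM p hp).trans (le_max_left _ _)) (norm_nonneg _)
        have h3 : ε / (s + 1) * |val u p.1 p.2| ^ (s + 1) =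
          ε * (|val u p.1 p.2| ^ (s + 1) / (s + 1)) := by ring
        linarith
    _ = ε * powInt s u + C * (volume Q).toReal := by
        rw [integral_add (hi3.const_mul ε) hi4, integral_const_mul, setIntegral_const, powInt,
          smul_eq_mul, mul_comm C]
        rfl

/-! ### The cut-off and the decay along rays -/

/-- The three pieces are glued at `1` and `2`; vanishing at the point `2` itself comes from
continuity. -/
theorem IsCutoff.antitone {χ : ℝ → ℝ} (h : IsCutoff χ) : Antitone χ := by
  have hc : Continuous χ := h.smooth.continuous
  have h2 : ∀ t, 2 ≤ t → χ t = 0 := by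
    have : EqOn χ 0 (closure (Ioi 2)) :=
      EqOn.closure (fun t ht => h.eq_zero t ht) hc continuous_const
    rw [closure_Ioi] at this
    exact fun t ht => this ht
  have a1 : AntitoneOn χ (Iic 1) := fun x hx y hy _ => by rw [h.eq_one x hx, h.eq_one y hy]
  have a2 : AntitoneOn χ (Icc 1 2) := by
    refine antitoneOn_of_deriv_nonpos (convex_Icc 1 2) hc.continuousOn
      (h.smooth.differentiable (by simp)).differentiableOn fun t ht => ?_
    rw [interior_Icc] at ht
    exact (h.deriv_mem t ht.1 ht.2).2.le
  have a3 : AntitoneOn χ (Ici 2) := fun x hx y hy _ => by rw [h2 x hx, h2 y hy]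
  have a4 : AntitoneOn χ (Ici 1) := by
    have := a2.union_right a3 (isGreatest_Icc (by norm_num)) isLeast_Ici
    rwa [Icc_union_Ici_eq_Ici (by norm_num)] at this
  exact a1.Iic_union_Ici a4

theorem IsCutoff.le_one {χ : ℝ → ℝ} (h : IsCutoff χ) (t : ℝ) : χ t ≤ 1 := by
  rw [← h.eq_one (min t 1) (min_le_right _ _)]
  exact h.antitone (min_le_left _ _)

theorem IsCutoff.nonneg {χ : ℝ → ℝ} (h : IsCutoff χ) (t : ℝ) : 0 ≤ χ t := by
  rw [← h.eq_zero (max t 3) (by have := le_max_right t 3; linarith)]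
  exact h.antitone (le_max_left _ _)

/-- Bernoulli's inequality for the base `τ ^ 2` and the exponent `(s + 1) / 2`. -/
theorem one_add_mul_le_rpow {s τ : ℝ} (hs : 1 < s) (hτ : 1 ≤ τ) :
    (s + 1) / 2 * (τ ^ 2 - 1) ≤ τ ^ (s + 1) - 1 := by
  have h := one_add_mul_self_le_rpow_one_add (s := τ ^ 2 - 1) (by nlinarith)
    (show 1 ≤ (s + 1) / 2 by linarith)
  rw [add_sub_cancel, ← Real.rpow_natCast τ 2, ← Real.rpow_mul (by linarith)] at h
  have h2 : ((2 : ℕ) : ℝ) * ((s + 1) / 2) = s + 1 := by push_cast; ring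
  rw [h2, Real.rpow_natCast] at h
  linarith

/-- Along a ray, the quadratic growth is dominated once the superlinear term is large. -/
theorem ray_le {s τ a B l C κ : ℝ} (hs : 1 < s) (hτ : 1 ≤ τ) (hB : 0 ≤ B) (hl : 0 ≤ l)
    (hκ1 : κ ≤ 1) (ha : a ≤ B + C) (h : C + l / 2 ≤ (s - 1) / 2 * B) :
    τ ^ 2 * a - τ ^ (s + 1) * B + κ * (τ * l) ≤ a - B + κ * l := by
  have h1 := mul_le_mul_of_nonneg_right (one_add_mul_le_rpow hs hτ) hB
  have h2 : 0 ≤ τ ^ 2 - 1 := by nlinarith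
  have h3 := mul_le_mul_of_nonneg_left ha h2
  have h4 := mul_le_mul_of_nonneg_left h h2
  have h5 : κ * l * (τ - 1) ≤ l * ((τ ^ 2 - 1) / 2) := by
    have h6 : κ * l ≤ l := by nlinarith
    have h7 : τ - 1 ≤ (τ ^ 2 - 1) / 2 := by nlinarith [sq_nonneg (τ - 1)]
    exact mul_le_mul h6 h7 (by linarith) hl
  nlinarith

/-- The difficulty is that the cut-off factor changes along the ray. It only matters where the
forcing term raises `J`, and there either `J ≤ I < 0` or the factor does not increase, so `ray_le`
applies with the factor frozen. -/
theorem functionalJ_smul_le {s : ℝ} (hs : 1 < s) {f : ℝ × ℝ → ℝ} (hf : ContinuousOn f Q)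
    {χ : ℝ → ℝ} (hχ : IsCutoff χ) {a₆ : ℝ} (ha₆ : 0 < a₆) (β : ℝ) {C : ℝ} (hC : 0 ≤ C)
    {u : TrigPoly} (hN : 1 / 2 * quad (waveWeight β) u ≤ powInt s u + C)
    (hJ : functionalJ s f χ a₆ β u ≤ C)
    (hB : C + |forcing f u| / 2 ≤ (s - 1) / 2 * powInt s u) {τ : ℝ} (hτ : 1 ≤ τ) :
    functionalJ s f χ a₆ β (τ • u) ≤ C := by
  have hτ0 : 0 ≤ τ := by linarith
  have hray := fun κ h1 => ray_le (κ := κ) hs hτ (powInt_nonneg hs u)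
    (abs_nonneg (forcing f u)) h1 hN hB
  have hψ0 : ∀ v, 0 ≤ cutoffψ s f χ a₆ β v := fun v => hχ.nonneg _
  have hψ1 : ∀ v, cutoffψ s f χ a₆ β v ≤ 1 := fun v => hχ.le_one _
  have hIτ : functionalI s f β (τ • u) = τ ^ 2 * (1 / 2 * quad (waveWeight β) u) -
      τ ^ (s + 1) * powInt s u - τ * forcing f u := by
    rw [functionalI_eq hs hf, quad_smul, powInt_smul s hτ0, forcing_smul]; ring
  have hI := functionalI_eq hs hf β u
  have hJτ : functionalJ s f χ a₆ β (τ • u) = τ ^ 2 * (1 / 2 * quad (waveWeight β) u) -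
      τ ^ (s + 1) * powInt s u - cutoffψ s f χ a₆ β (τ • u) * (τ * forcing f u) := by
    rw [functionalJ_eq hs hf, quad_smul, powInt_smul s hτ0, forcing_smul]; ring
  rw [functionalJ_eq hs hf] at hJ
  rcases le_total 0 (forcing f u) with hL | hL
  · have h1 := hray 0 zero_le_one
    have h2 := mul_nonneg (hψ0 (τ • u)) (mul_nonneg hτ0 hL)
    rw [hJτ]; linarith
  · rw [abs_of_nonpos hL] at hray
    rcases lt_or_ge (functionalI s f β (τ • u)) 0 with hneg | hpos
    · have h2 : cutoffψ s f χ a₆ β (τ • u) * (τ * -forcing f u) ≤ τ * -forcing f u :=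
        mul_le_of_le_one_left (mul_nonneg hτ0 (by linarith)) (hψ1 _)
      rw [hJτ]; linarith
    · have h1 := hray 1 le_rfl
      have hle : functionalI s f β (τ • u) ≤ functionalI s f β u := by rw [hIτ, hI]; linarith
      have hψ : cutoffψ s f χ a₆ β (τ • u) ≤ cutoffψ s f χ a₆ β u := by
        refine hχ.antitone ?_
        have hsq : functionalI s f β (τ • u) ^ 2 ≤ functionalI s f β u ^ 2 :=
          pow_le_pow_left₀ hpos hle 2
        have hpow : powInt s u ≤ powInt s (τ • u) := by
          rw [powInt_smul s hτ0]
          exact le_mul_of_one_le_left (powInt_nonneg hs u)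
            (Real.one_le_rpow hτ (by linarith))
        change _ * powInt s u ≤ _ * powInt s (τ • u)
        have := powInt_nonneg hs u
        gcongr
      have h2 := hray _ (hψ1 u)
      have h3 := mul_le_mul_of_nonneg_right hψ (mul_nonneg hτ0 (neg_nonneg.2 hL))
      rw [hJτ]; linarith

/-! ### The reduced functional -/

open Classical in
/-- The weights `waveWeight β`, without those of `e₁, …, eₙ`. -/
noncomputable def reducedWeight (e : ℕ ≃ PosMode) (n : ℕ) (β : ℝ) (i : Mode) : ℝ :=
  if ∃ l < n, i = (e l).1 then 0 else waveWeight β i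

theorem reducedWeight_le (e : ℕ ≃ PosMode) (n : ℕ) (β : ℝ) (i : Mode) :
    reducedWeight e n β i ≤ waveWeight β i := by
  unfold reducedWeight
  split_ifs with h
  · obtain ⟨l, -, rfl⟩ := h
    exact (waveWeight_pos (e l).2).le
  · exact le_rfl

theorem reducedWeight_nonpos {e : ℕ ≃ PosMode} {n m : ℕ} {β : ℝ} (hβ : 0 < β) {i : Mode}
    (hi : i ∈ modes e n m) : reducedWeight e n β i ≤ 0 := by
  unfold reducedWeight
  split_ifs with h
  · exact le_rfl
  · refine (waveWeight_neg hβ ?_).le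
    rcases mem_modes.1 hi with h' | h' | h'
    · exact absurd h' h
    · omega
    · omega

/-- The dropped weights belong to indices `l < n`, so by monotonicity the eigenvalue at index `n`
bounds them all, including when `n = 0` and nothing is dropped. -/
theorem waveWeight_le_reducedWeight {e : ℕ ≃ PosMode}
    (he : Monotone fun l => (e l).1.eigenvalue) (n : ℕ) (β : ℝ) (i : Mode) :
    waveWeight β i ≤ reducedWeight e n β i + |((e n).1.eigenvalue : ℝ)| * i.normSq := by
  unfold reducedWeight
  split_ifs with h
  · obtain ⟨l, hl, rfl⟩ := h
    have h1 : (((e l).1.eigenvalue : ℤ) : ℝ) ≤ (e n).1.eigenvalue := by exact_mod_cast he hl.le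
    rw [waveWeight, if_neg (e l).2.ne, zero_add, mul_comm]
    exact mul_le_mul_of_nonneg_right (h1.trans (le_abs_self _)) (Mode.normSq_pos _).le
  · have := i.normSq_pos
    have : 0 ≤ |((e n).1.eigenvalue : ℝ)| * i.normSq := by positivity
    linarith

/-- An upper bound, up to a constant, for `J`, which is concave on `E^{+n} ⊕ E^{-m} ⊕ N^m` and
its translates. -/
noncomputable def reducedJ (s : ℝ) (e : ℕ ≃ PosMode) (n : ℕ) (β : ℝ) (u : TrigPoly) : ℝ :=
  1 / 2 * quad (reducedWeight e n β) u - 2 ^ (1 - s) * powInt s u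

/-- The fraction `1 - 2 ^ (1 - s)` of the superlinear term, positive since `s > 1`, pays for the
dropped weights and for the forcing. -/
theorem exists_functionalJ_le {s : ℝ} (hs : 1 < s) {f : ℝ × ℝ → ℝ} (hf : ContinuousOn f Q)
    {e : ℕ ≃ PosMode} (he : Monotone fun l => (e l).1.eigenvalue) (n : ℕ) :
    ∃ C, 0 ≤ C ∧ ∀ χ, IsCutoff χ → ∀ a₆ β u,
      functionalJ s f χ a₆ β u ≤ reducedJ s e n β u + C := by
  have hκ : (2 : ℝ) ^ (1 - s) < 1 := Real.rpow_lt_one_of_one_lt_of_neg one_lt_two (by linarith)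
  obtain ⟨C, hC0, hC⟩ := exists_lower_order_le hs hf
    (A := 1 / 2 * |((e n).1.eigenvalue : ℝ)|) (by positivity) (sub_pos.2 hκ)
  refine ⟨C, hC0, fun χ hχ a₆ β u => ?_⟩
  rw [functionalJ_eq hs hf, reducedJ]
  have h1 : quad (waveWeight β) u ≤
      quad (reducedWeight e n β) u + |((e n).1.eigenvalue : ℝ)| * quad Mode.normSq u := by
    rw [← quad_add_weight]
    exact quad_le_quad fun i _ => waveWeight_le_reducedWeight he n β i
  have h2 : -(cutoffψ s f χ a₆ β u * forcing f u) ≤ |forcing f u| := by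
    refine (neg_le_abs _).trans ?_
    rw [abs_mul, abs_of_nonneg (show 0 ≤ cutoffψ s f χ a₆ β u from hχ.nonneg _)]
    exact mul_le_of_le_one_left (abs_nonneg _) (hχ.le_one _)
  have := hC u
  linarith

theorem reducedJ_nonpos {s : ℝ} (hs : 1 < s) {e : ℕ ≃ PosMode} {n m : ℕ} {β : ℝ} (hβ : 0 < β)
    {u : TrigPoly} (hu : u ∈ Finsupp.supported ℝ ℝ (modes e n m : Set Mode)) :
    reducedJ s e n β u ≤ 0 := by
  have h1 : quad (reducedWeight e n β) u ≤ 0 :=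
    quad_nonpos fun i hi => reducedWeight_nonpos hβ ((Finsupp.mem_supported ℝ u).1 hu hi)
  have h2 := mul_nonneg (Real.rpow_nonneg zero_le_two (1 - s)) (powInt_nonneg hs u)
  rw [reducedJ]; linarith

theorem continuous_quad_comp {α : Type*} [TopologicalSpace α] (W : Mode → ℝ) {S : Finset Mode}
    {g : α → TrigPoly} (hg : Continuous g)
    (hS : ∀ x, g x ∈ Finsupp.supported ℝ ℝ (S : Set Mode)) :
    Continuous fun x => quad W (g x) := by
  simp_rw [fun x => quad_eq_sum W (hS x)]
  exact continuous_finsetSum _ fun i _ => (((continuous_coeff i).comp hg).pow 2).const_mul _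

/-- Stretching the points at which the reduced quadratic form is large. -/
theorem exists_stretching {s : ℝ} (hs : 1 < s) {f : ℝ × ℝ → ℝ} (hf : ContinuousOn f Q)
    (e : ℕ ≃ PosMode) (n : ℕ) {C : ℝ} (hC : 0 ≤ C) :
    ∃ C', 0 ≤ C' ∧ ∀ χ, IsCutoff χ → ∀ a₆, 0 < a₆ → ∀ β, ∀ S : Finset Mode,
      ∀ K : Type, ∀ _ : TopologicalSpace K, ∀ h : K → TrigPoly, Continuous h →
      (∀ x, h x ∈ Finsupp.supported ℝ ℝ (S : Set Mode)) →
      (∀ x, 1 / 2 * quad (waveWeight β) (h x) ≤ powInt s (h x) + C) →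
      (∀ x, functionalJ s f χ a₆ β (h x) ≤ C) →
      ∃ c : ℝ × K → ℝ, Continuous c ∧ (∀ x, c (0, x) = 1) ∧
        (∀ z, functionalJ s f χ a₆ β (c z • h z.2) ≤ C) ∧
        ∀ x, reducedJ s e n β (c (1, x) • h x) ≤ C' := by
  obtain ⟨C₁, hC₁0, hC₁⟩ := exists_lower_order_le hs hf le_rfl
    (show 0 < (s - 1) / 2 by linarith)
  have hs1 : 0 < s - 1 := by linarith
  -- If the reduced form is at least `A`, the bound on the wave form makes `powInt` at least `(C +
  -- C₁ / 2) * (4 / (s - 1))`. This is what the hypothesis of `functionalJ_smul_le` requires, given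
  -- `|forcing| ≤ (s - 1) / 2 * powInt + C₁`.
  set A : ℝ := 2 * (C + (C + C₁ / 2) * (4 / (s - 1))) + 1 with hA
  have hA0 : 0 < A := by positivity
  refine ⟨4 * A + 4 * C, by positivity, fun χ hχ a₆ ha₆ β S K _ h hcont hS hN hJ => ?_⟩
  have hred : ∀ x, quad (reducedWeight e n β) (h x) ≤ quad (waveWeight β) (h x) := fun x =>
    quad_le_quad fun i _ => reducedWeight_le e n β i
  have hc := continuous_quad_comp (reducedWeight e n β) hcont hS
  -- No stretching where the reduced form is at most `A`; the full factor `2` at time `1` where it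
  -- is at least `2 * A`.
  refine ⟨fun z => 1 + clamp z.1 * clamp (quad (reducedWeight e n β) (h z.2) / A - 1),
    ?_, fun x => ?_, fun z => ?_, fun x => ?_⟩
  · exact continuous_const.add ((continuous_clamp.comp continuous_fst).mul
      (continuous_clamp.comp (((hc.comp continuous_snd).div_const A).sub continuous_const)))
  · simp [clamp_of_nonpos le_rfl]
  · have hτ : 1 ≤ 1 + clamp z.1 * clamp (quad (reducedWeight e n β) (h z.2) / A - 1) := by
      have := mul_nonneg (clamp_nonneg z.1)
        (clamp_nonneg (quad (reducedWeight e n β) (h z.2) / A - 1))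
      linarith
    rcases le_total (quad (reducedWeight e n β) (h z.2)) A with hle | hge
    · dsimp only
      rw [clamp_of_nonpos (r := _ / A - 1) (by rw [sub_nonpos]; exact div_le_one_of_le₀ hle hA0.le),
        mul_zero, add_zero, one_smul]
      exact hJ z.2
    · refine functionalJ_smul_le hs hf hχ ha₆ β hC (hN z.2) (hJ z.2) ?_ hτ
      have h1 := hC₁ (h z.2)
      rw [zero_mul, zero_add] at h1
      have h2 : (C + C₁ / 2) * (4 / (s - 1)) ≤ powInt s (h z.2) := by
        have := hN z.2; have := hred z.2; linarith
      have h3 : C + C₁ / 2 ≤ (s - 1) / 4 * powInt s (h z.2) := by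
        have h4 := mul_le_mul_of_nonneg_left h2 (show 0 ≤ (s - 1) / 4 by linarith)
        have h5 : (s - 1) / 4 * ((C + C₁ / 2) * (4 / (s - 1))) = C + C₁ / 2 := by
          field_simp
        linarith
      linarith
  · dsimp only
    rw [clamp_of_one_le le_rfl, one_mul]
    set b := quad (reducedWeight e n β) (h x)
    set θ := clamp (b / A - 1) with hθ
    have hθ0 : 0 ≤ θ := clamp_nonneg _
    have hθ1 : θ ≤ 1 := clamp_le_one _
    rw [reducedJ, quad_smul, powInt_smul s (by linarith)]
    have hB := powInt_nonneg hs (h x)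
    rcases le_total b (2 * A) with hle | hge
    · have h1 : (1 + θ) ^ 2 * b ≤ 8 * A := by
        have : (1 + θ) ^ 2 * b ≤ (1 + θ) ^ 2 * (2 * A) :=
          mul_le_mul_of_nonneg_left hle (sq_nonneg _)
        have h4 : (1 + θ) ^ 2 ≤ 4 := by nlinarith
        nlinarith
      have h2 : 0 ≤ 2 ^ (1 - s) * ((1 + θ) ^ (s + 1) * powInt s (h x)) := by positivity
      change 1 / 2 * ((1 + θ) ^ 2 * b) - _ ≤ _
      linarith
    · have h1 : θ = 1 := clamp_of_one_le (by
        rw [le_sub_iff_add_le, le_div_iff₀ hA0]; linarith)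
      -- The coefficient `2 ^ (1 - s)` is chosen so that, after doubling, both terms scale by `4`
      -- relative to half the form minus `powInt`, giving at most `4 * C`.
      have h2 : (2 : ℝ) ^ (1 - s) * (2 ^ (s + 1) * powInt s (h x)) = 4 * powInt s (h x) := by
        rw [← mul_assoc, ← Real.rpow_add two_pos,
          show 1 - s + (s + 1) = ((2 : ℕ) : ℝ) by push_cast; ring, Real.rpow_natCast]
        norm_num
      have h3 := hN x
      have h4 := hred x
      rw [h1, one_add_one_eq_two, h2]
      linarith

/-! ### Concavity and decay of the reduced functional along the Galerkin space. -/

theorem quad_add_emb (W : Mode → ℝ) {S S' : Finset Mode} (h : Disjoint S S') (x : S → ℝ)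
    (y : S' → ℝ) :
    quad W (emb S x + emb S' y) = (∑ i : S, W i * x i ^ 2) + ∑ i : S', W i * y i ^ 2 := by
  classical
  rw [← quad_emb, ← quad_emb]
  refine Finsupp.sum_add_index_of_disjoint ?_ _
  have h1 : ((emb S x).support : Set Mode) ⊆ S :=
    (Finsupp.mem_supported ℝ _).1 (emb_mem_supported S x)
  have h2 : ((emb S' y).support : Set Mode) ⊆ S' :=
    (Finsupp.mem_supported ℝ _).1 (emb_mem_supported S' y)
  exact Finset.disjoint_of_subset_left (by exact_mod_cast h1)
    (Finset.disjoint_of_subset_right (by exact_mod_cast h2) h)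

theorem proj_add_proj_sdiff [DecidableEq Mode] {S S' : Finset Mode} {u : TrigPoly}
    (hu : u ∈ Finsupp.supported ℝ ℝ (S' : Set Mode)) : proj S u + proj (S' \ S) u = u := by
  ext i
  rw [Finsupp.add_apply]
  by_cases h : i ∈ S
  · rw [proj_apply_of_mem u h, proj_apply_of_notMem u (by simp [h]), add_zero]
  · rw [proj_apply_of_notMem u h, zero_add]
    by_cases h' : i ∈ S'
    · exact proj_apply_of_mem u (by simp [h, h'])
    · rw [proj_apply_of_notMem u (by simp [h']), (Finsupp.mem_supported' ℝ u).1 hu i h']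

/-- The modes of `p` carry nonpositive reduced weights, the form has no cross terms with `y`, and
`powInt` is convex. -/
theorem concaveOn_reducedJ {s : ℝ} (hs : 1 < s) {e : ℕ ≃ PosMode} {n m : ℕ} {β : ℝ} (hβ : 0 < β)
    {S' : Finset Mode} (hd : Disjoint (modes e n m) S') (y : S' → ℝ) :
    ConcaveOn ℝ univ fun p : modes e n m → ℝ =>
      reducedJ s e n β (emb (modes e n m) p + emb S' y) := by
  refine ⟨convex_univ, fun p _ q _ a b ha hb hab => ?_⟩
  simp only [reducedJ, quad_add_emb _ hd, smul_eq_mul]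
  have h1 : emb (modes e n m) (a • p + b • q) + emb S' y =
      a • (emb (modes e n m) p + emb S' y) + b • (emb (modes e n m) q + emb S' y) := by
    rw [map_add, map_smul, map_smul, smul_add, smul_add, add_add_add_comm, ← add_smul, hab,
      one_smul]
  have h2 := (convexOn_powInt hs).2 (mem_univ (emb (modes e n m) p + emb S' y))
    (mem_univ (emb (modes e n m) q + emb S' y)) ha hb hab
  rw [← h1] at h2
  simp only [smul_eq_mul] at h2
  have h3 : a * (∑ i : modes e n m, reducedWeight e n β i * p i ^ 2) +
      b * (∑ i : modes e n m, reducedWeight e n β i * q i ^ 2) ≤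
      ∑ i : modes e n m, reducedWeight e n β i * (a • p + b • q) i ^ 2 := by
    rw [Finset.mul_sum, Finset.mul_sum, ← Finset.sum_add_distrib]
    refine Finset.sum_le_sum fun i _ => ?_
    simp only [Pi.add_apply, Pi.smul_apply, smul_eq_mul]
    have h4 : (a * p i + b * q i) ^ 2 ≤ a * p i ^ 2 + b * q i ^ 2 := by
      have : b = 1 - a := by linarith
      subst this
      nlinarith [mul_nonneg (mul_nonneg ha hb) (sq_nonneg (p i - q i))]
    nlinarith [mul_le_mul_of_nonpos_left h4 (reducedWeight_nonpos hβ i.2)]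
  have h5 : 0 ≤ (2 : ℝ) ^ (1 - s) := by positivity
  have h6 := mul_le_mul_of_nonneg_left h2 h5
  have h7 : (a + b) * (∑ i : S', reducedWeight e n β i * y i ^ 2) =
    ∑ i : S', reducedWeight e n β i * y i ^ 2 := by rw [hab, one_mul]
  linarith

theorem continuous_reducedJ {s : ℝ} (hs : 1 < s) (e : ℕ ≃ PosMode) (n : ℕ) (β : ℝ)
    {S S' : Finset Mode} (hd : Disjoint S S') :
    Continuous fun z : (S → ℝ) × (S' → ℝ) => reducedJ s e n β (emb S z.1 + emb S' z.2) := by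
  have h := continuous_powInt_comp hs ((emb S).coprod (emb S'))
  simp only [LinearMap.coprod_apply] at h
  simp only [reducedJ, quad_add_emb _ hd]
  fun_prop

theorem one_le_normSq (i : Mode) : 1 ≤ i.normSq := by
  have := Real.pi_gt_three
  unfold Mode.normSq
  split_ifs <;> nlinarith

/-- The reduced functional tends to `-∞` on the Galerkin space, locally uniformly in the
remaining modes. -/
theorem exists_reducedJ_le {s : ℝ} (hs : 1 < s) {e : ℕ ≃ PosMode} {n m : ℕ} {β : ℝ}
    (hβ : 0 < β) {S' : Finset Mode} (hd : Disjoint (modes e n m) S') (K : Type)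
    [TopologicalSpace K] [CompactSpace K] (y : C(K, S' → ℝ)) {C : ℝ} (hC : 0 ≤ C) :
    ∃ T, ∀ q : modes e n m → ℝ, T ≤ ‖q‖ → ∀ x, ∀ θ ∈ Icc (0 : ℝ) 1,
      reducedJ s e n β (emb (modes e n m) q + emb S' (θ • y x)) ≤ C := by
  obtain ⟨C₁, hC₁0, hC₁⟩ := exists_lower_order_le hs (f := 0) continuousOn_const zero_le_one
    (show (0 : ℝ) < 2 ^ (1 - s) by positivity)
  have hcont : Continuous fun x => ∑ i : S', |reducedWeight e n β i| * y x i ^ 2 :=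
    continuous_finsetSum _ fun i _ => ((((continuous_apply i).comp y.continuous)).pow 2).const_mul _
  obtain ⟨M, hM⟩ := isCompact_univ.exists_bound_of_continuousOn hcont.continuousOn
  -- The first `n` positive modes have reduced weight zero, so the decay in `q` comes from `powInt`,
  -- which dominates the `L²` norm and hence `‖q‖ ^ 2` up to `C₁`. `M` bounds the contribution of `θ
  -- • y x`.
  refine ⟨max M 0 + C₁ + 1, fun q hq x θ hθ => ?_⟩
  have h1 := hC₁ (emb (modes e n m) q + emb S' (θ • y x))
  rw [one_mul, quad_add_emb _ hd] at h1
  have h2 := abs_nonneg (forcing 0 (emb (modes e n m) q + emb S' (θ • y x)))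
  have h3 : 0 ≤ ∑ i : S', (i : Mode).normSq * (θ • y x) i ^ 2 :=
    Finset.sum_nonneg fun i _ => mul_nonneg (Mode.normSq_pos _).le (sq_nonneg _)
  have h4 : ∑ i : modes e n m, reducedWeight e n β i * q i ^ 2 ≤ 0 :=
    Finset.sum_nonpos fun i _ =>
      mul_nonpos_of_nonpos_of_nonneg (reducedWeight_nonpos hβ i.2) (sq_nonneg _)
  have h5 : ∑ i : S', reducedWeight e n β i * (θ • y x) i ^ 2 ≤ max M 0 := by
    refine le_trans (Finset.sum_le_sum fun i _ => ?_)
      ((le_abs_self _).trans ((hM x (mem_univ x)).trans (le_max_left M 0)))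
    simp only [Pi.smul_apply, smul_eq_mul, mul_pow]
    have hθ2 : θ ^ 2 ≤ 1 := pow_le_one₀ hθ.1 hθ.2
    calc reducedWeight e n β i * (θ ^ 2 * y x i ^ 2)
        ≤ |reducedWeight e n β i| * (θ ^ 2 * y x i ^ 2) :=
          mul_le_mul_of_nonneg_right (le_abs_self _) (by positivity)
      _ ≤ |reducedWeight e n β i| * (1 * y x i ^ 2) := by gcongr
      _ = _ := by rw [one_mul]
  have h6 : ‖q‖ ^ 2 ≤ ∑ i : modes e n m, (i : Mode).normSq * q i ^ 2 := by
    have hT0 : 0 ≤ ∑ i : modes e n m, (i : Mode).normSq * q i ^ 2 :=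
      Finset.sum_nonneg fun i _ => mul_nonneg (Mode.normSq_pos _).le (sq_nonneg _)
    have : ‖q‖ ≤ Real.sqrt (∑ i : modes e n m, (i : Mode).normSq * q i ^ 2) := by
      refine (pi_norm_le_iff_of_nonneg (Real.sqrt_nonneg _)).2 fun i => Real.le_sqrt_of_sq_le ?_
      rw [Real.norm_eq_abs, sq_abs]
      refine le_trans ?_ (Finset.single_le_sum
        (f := fun i : modes e n m => (i : Mode).normSq * q i ^ 2)
        (fun i _ => mul_nonneg (Mode.normSq_pos _).le (sq_nonneg _)) (Finset.mem_univ i))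
      exact le_mul_of_one_le_left (sq_nonneg _) (one_le_normSq _)
    calc ‖q‖ ^ 2 ≤ _ := pow_le_pow_left₀ (norm_nonneg q) this 2
      _ = _ := Real.sq_sqrt hT0
  have h7 : max M 0 + C₁ + 1 ≤ ‖q‖ ^ 2 := by
    have := le_max_right M 0
    nlinarith
  rw [reducedJ, quad_add_emb _ hd]
  have := le_max_right M 0
  linarith

/-! ### Deforming families of points into the Galerkin space. -/

/-- Deformation of a family of points of a sublevel set of the reduced functional into the
Galerkin space. -/
theorem exists_deformation_reducedJ {s : ℝ} (hs : 1 < s) {e : ℕ ≃ PosMode} {n m : ℕ} {β : ℝ}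
    (hβ : 0 < β) {S : Finset Mode} {C : ℝ} (hC : 0 ≤ C) {K : Type}
    [TopologicalSpace K] [CompactSpace K] [T2Space K] {ι : K → modes e n m → ℝ}
    (hι : Topology.IsClosedEmbedding ι) {h : K → TrigPoly} (hcont : Continuous h)
    (hS : ∀ x, h x ∈ Finsupp.supported ℝ ℝ (S : Set Mode)) (hsub : modes e (n + 1) m ⊆ S)
    (hJ : ∀ x, reducedJ s e (n + 1) β (h x) ≤ C) :
    ∃ G : ℝ × K → TrigPoly, Continuous G ∧ (∀ x, G (0, x) = h x) ∧
      (∀ x, G (1, x) ∈ Finsupp.supported ℝ ℝ (modes e (n + 1) m : Set Mode)) ∧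
      (∀ z, G z ∈ Finsupp.supported ℝ ℝ (S : Set Mode)) ∧
      (∀ z, reducedJ s e (n + 1) β (G z) ≤ C + 2) ∧
      ∀ x, h x ∈ Finsupp.supported ℝ ℝ (modes e (n + 1) m : Set Mode) →
        ∀ r, G (r, x) ∈ Finsupp.supported ℝ ℝ (modes e (n + 1) m : Set Mode) := by
  classical
  set P := modes e (n + 1) m
  have hd : Disjoint P (S \ P) := Finset.disjoint_sdiff
  let p : C(K, P → ℝ) := ⟨fun x => coeffs P (h x), (continuous_coeffs P).comp hcont⟩
  let y : C(K, ↥(S \ P) → ℝ) :=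
    ⟨fun x => coeffs (S \ P) (h x), (continuous_coeffs (S \ P)).comp hcont⟩
  have hpy : ∀ x, emb P (p x) + emb (S \ P) (y x) = h x := fun x => proj_add_proj_sdiff (hS x)
  -- The mode `e_{n+1}` is the one extra dimension that allows the perturbed map to avoid zero.
  have hcard : Module.finrank ℝ (modes e n m → ℝ) < Module.finrank ℝ (P → ℝ) := by
    simp only [Module.finrank_fintype_fun_eq_card, Fintype.card_coe, P]
    rw [modes_succ, Finset.card_insert_of_notMem (notMem_modes e n m)]
    exact Nat.lt_succ_self _
  obtain ⟨T, hT⟩ := exists_reducedJ_le hs hβ hd K y hC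
  obtain ⟨G, hG, hG0, hG1, hGE, hGy⟩ := exists_deformation_into_factor
    (E := fun p y => reducedJ s e (n + 1) β (emb P p + emb (S \ P) y))
    (continuous_reducedJ hs e (n + 1) β hd) (concaveOn_reducedJ hs hβ hd) p y hT
    (fun x => by rw [hpy]; exact hJ x)
    (fun k ε hε => exists_nonvanishing_approx hι hcard k hε) (isCompact_closedBall _ _)
  have hPS : Finsupp.supported ℝ ℝ (P : Set Mode) ≤ Finsupp.supported ℝ ℝ (S : Set Mode) :=
    Finsupp.supported_mono (by exact_mod_cast hsub)
  have hYS : Finsupp.supported ℝ ℝ ((S \ P : Finset Mode) : Set Mode) ≤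
      Finsupp.supported ℝ ℝ (S : Set Mode) :=
    Finsupp.supported_mono (by exact_mod_cast Finset.sdiff_subset)
  refine ⟨fun z => emb P (G z).1 + emb (S \ P) (G z).2, ?_, fun x => ?_, fun x => ?_,
    fun z => ?_, hGE, fun x hx r => ?_⟩
  · exact ((continuous_emb P).comp (continuous_fst.comp hG)).add
      ((continuous_emb _).comp (continuous_snd.comp hG))
  · dsimp only
    rw [hG0 x 0 le_rfl]; exact hpy x
  · dsimp only
    rw [hG1 x 1 le_rfl, map_zero, add_zero]; exact emb_mem_supported _ _
  · exact add_mem (hPS (emb_mem_supported _ _)) (hYS (emb_mem_supported _ _))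
  · dsimp only
    rw [hGy x ?_ r, map_zero, add_zero]
    · exact emb_mem_supported _ _
    · funext i
      exact (Finsupp.mem_supported' ℝ _).1 hx i (Finset.mem_sdiff.1 i.2).2

/-- Deformation of a family of points of a sublevel set of `J` into the Galerkin space. -/
theorem exists_deformation {s : ℝ} (hs : 1 < s) {f : ℝ × ℝ → ℝ} (hf : ContinuousOn f Q)
    {e : ℕ ≃ PosMode} (he : Monotone fun l => (e l).1.eigenvalue) (n : ℕ) :
    ∃ C C', 0 ≤ C ∧ C ≤ C' ∧ ∀ χ, IsCutoff χ → ∀ a₆, 0 < a₆ → ∀ β, 0 < β → ∀ m,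
      (∀ u ∈ Finsupp.supported ℝ ℝ (modes e (n + 1) m : Set Mode),
        functionalJ s f χ a₆ β u ≤ C) ∧
      ∀ S : Finset Mode, modes e (n + 1) m ⊆ S → ∀ (K : Type) [TopologicalSpace K]
        [CompactSpace K] [T2Space K] (ι : K → modes e n m → ℝ), Topology.IsClosedEmbedding ι →
        ∀ h : K → TrigPoly, Continuous h →
        (∀ x, h x ∈ Finsupp.supported ℝ ℝ (S : Set Mode)) →
        (∀ x, 1 / 2 * quad (waveWeight β) (h x) ≤ powInt s (h x) + C) →
        (∀ x, functionalJ s f χ a₆ β (h x) ≤ C) →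
        ∃ G : ℝ × K → TrigPoly, Continuous G ∧ (∀ x, G (0, x) = h x) ∧
          (∀ x, G (1, x) ∈ Finsupp.supported ℝ ℝ (modes e (n + 1) m : Set Mode)) ∧
          (∀ z, G z ∈ Finsupp.supported ℝ ℝ (S : Set Mode)) ∧
          (∀ z, functionalJ s f χ a₆ β (G z) ≤ C') ∧
          ∀ x, h x ∈ Finsupp.supported ℝ ℝ (modes e (n + 1) m : Set Mode) →
            ∀ r, G (r, x) ∈ Finsupp.supported ℝ ℝ (modes e (n + 1) m : Set Mode) := by
  obtain ⟨C, hC0, hC⟩ := exists_functionalJ_le hs hf he (n + 1)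
  obtain ⟨C₁, hC₁0, hC₁⟩ := exists_stretching hs hf e (n + 1) hC0
  -- Stretching brings `reducedJ` below `C₁`, the deformation costs `2`, and returning from
  -- `reducedJ` to `J` costs `C`.
  refine ⟨C, C₁ + 2 + C, hC0, by linarith, fun χ hχ a₆ ha₆ β hβ m => ⟨fun u hu => ?_, ?_⟩⟩
  · have := hC χ hχ a₆ β u
    have := reducedJ_nonpos hs hβ hu
    linarith
  intro S hsub K _ _ _ ι hι h hcont hS hN hJ
  obtain ⟨c, hc, hc0, hcJ, hc1⟩ := hC₁ χ hχ a₆ ha₆ β S K _ h hcont hS hN hJ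
  obtain ⟨G, hG, hG0, hG1, hGS, hGJ, hGP⟩ := exists_deformation_reducedJ (K := K) hs hβ hC₁0 hι
    (h := fun x => c (1, x) • h x) (by fun_prop) (fun x => Submodule.smul_mem _ _ (hS x)) hsub hc1
  refine ⟨fun z => if z.1 ≤ 1 / 2 then c (2 * z.1, z.2) • h z.2 else G (2 * z.1 - 1, z.2),
    Continuous.if_le (by fun_prop) (by fun_prop) continuous_fst continuous_const ?_,
    fun x => ?_, fun x => ?_, fun z => ?_, fun z => ?_, fun x hx r => ?_⟩
  · intro z hz
    rw [hz]; norm_num [hG0]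
  · norm_num [hc0]
  · norm_num
    exact hG1 x
  · dsimp only
    split_ifs
    · exact Submodule.smul_mem _ _ (hS _)
    · exact hGS _
  · dsimp only
    split_ifs
    · have := hcJ (2 * z.1, z.2)
      linarith
    · have := hC χ hχ a₆ β (G (2 * z.1 - 1, z.2))
      have := hGJ (2 * z.1 - 1, z.2)
      linarith
  · dsimp only
    split_ifs
    · exact Submodule.smul_mem _ _ hx
    · exact hGP x (Submodule.smul_mem _ _ hx) _

/-! ### The norm and the radial retraction -/

theorem normEβ_nonneg (β : ℝ) (u : TrigPoly) : 0 ≤ normEβ β u := Real.sqrt_nonneg _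

theorem normEβ_sq {β : ℝ} (hβ : 0 < β) (u : TrigPoly) :
    normEβ β u ^ 2 = quad (fun i => |waveWeight β i|) u := by
  rw [normEβ_eq hβ, Real.sq_sqrt (quad_nonneg fun i _ => abs_nonneg _)]

theorem normEβ_smul {β : ℝ} (hβ : 0 < β) (c : ℝ) (u : TrigPoly) :
    normEβ β (c • u) = |c| * normEβ β u := by
  rw [normEβ_eq hβ, normEβ_eq hβ, quad_smul, Real.sqrt_mul (sq_nonneg c), Real.sqrt_sq_eq_abs]

theorem normEβ_neg {β : ℝ} (hβ : 0 < β) (u : TrigPoly) : normEβ β (-u) = normEβ β u := by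
  rw [← neg_one_smul ℝ u, normEβ_smul hβ]; simp

theorem normEβ_zero {β : ℝ} (hβ : 0 < β) : normEβ β 0 = 0 := by
  rw [normEβ_eq hβ, quad_zero, Real.sqrt_zero]

/-- The projection is essential: the norm is not continuous for coefficientwise convergence on the
whole of `TrigPoly`. -/
theorem continuous_normEβ_proj {β : ℝ} (hβ : 0 < β) (S : Finset Mode) :
    Continuous fun u => normEβ β (proj S u) := by
  simp_rw [normEβ_eq hβ]
  exact (continuous_quad_comp _ (continuous_proj S) (proj_mem_supported S)).sqrt

/-- The radial retraction onto the ball of radius `r`. -/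
noncomputable def retract (β r : ℝ) (u : TrigPoly) : TrigPoly := (r / max r (normEβ β u)) • u

theorem retract_of_le {β r : ℝ} (hr : 0 < r) {u : TrigPoly} (h : normEβ β u ≤ r) :
    retract β r u = u := by
  rw [retract, max_eq_left h, div_self hr.ne', one_smul]

theorem normEβ_retract_of_le {β r : ℝ} (hβ : 0 < β) (hr : 0 < r) {u : TrigPoly}
    (h : r ≤ normEβ β u) : normEβ β (retract β r u) = r := by
  rw [retract, max_eq_right h, normEβ_smul hβ,
    abs_of_nonneg (div_nonneg hr.le (normEβ_nonneg _ _)), div_mul_cancel₀ _ (by linarith)]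

theorem normEβ_retract_le {β r : ℝ} (hβ : 0 < β) (hr : 0 < r) (u : TrigPoly) :
    normEβ β (retract β r u) ≤ r := by
  rcases le_total (normEβ β u) r with h | h
  · rwa [retract_of_le hr h]
  · exact (normEβ_retract_of_le hβ hr h).le

theorem continuous_retract_proj {β r : ℝ} (hβ : 0 < β) (hr : 0 < r) (S : Finset Mode) :
    Continuous fun u => retract β r (proj S u) := by
  have h1 := continuous_normEβ_proj hβ S
  have h2 := continuous_proj S
  have h3 : ∀ u, max r (normEβ β (proj S u)) ≠ 0 := fun u => (hr.trans_le (le_max_left _ _)).ne'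
  unfold retract
  exact (continuous_const.div (continuous_const.max h1) h3).smul h2

/-- For `β > 0` no weight vanishes, so the norm bounds each of the finitely many coefficients. -/
theorem isCompact_ball {β : ℝ} (hβ : 0 < β) (r : ℝ) (e : ℕ ≃ PosMode) (n m : ℕ) :
    IsCompact (ball β r (galerkin e n m)) := by
  set S := modes e n m with hS
  have hclosed : IsClosed {x : S → ℝ | normEβ β (proj S (emb S x)) ≤ r} :=
    isClosed_le ((continuous_normEβ_proj hβ S).comp (continuous_emb S)) continuous_const
  have hpe : ∀ x : S → ℝ, proj S (emb S x) = emb S x := fun x =>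
    proj_of_mem_supported (emb_mem_supported S x)
  have hcpt : IsCompact {x : S → ℝ | normEβ β (proj S (emb S x)) ≤ r} := by
    refine (isCompact_univ_pi fun i : S => isCompact_Icc
      (a := -(r / Real.sqrt |waveWeight β i|)) (b := r / Real.sqrt |waveWeight β i|)).of_isClosed_subset
      hclosed fun x hx i _ => ?_
    rw [mem_ofPred_eq, hpe, normEβ_eq hβ, quad_emb] at hx
    have hw : 0 < Real.sqrt |waveWeight β i| :=
      Real.sqrt_pos.2 (abs_pos.2 (waveWeight_ne_zero hβ i))
    rw [mem_Icc, ← abs_le, le_div_iff₀ hw]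
    refine le_trans ?_ hx
    refine Real.le_sqrt_of_sq_le ?_
    rw [mul_pow, sq_abs, Real.sq_sqrt (abs_nonneg _), mul_comm]
    exact Finset.single_le_sum (f := fun i : S => |waveWeight β i| * x i ^ 2)
      (fun i _ => by positivity) (Finset.mem_univ i)
  convert hcpt.image (continuous_emb S) using 1
  ext u
  simp only [ball, galerkin_eq, mem_ofPred_eq, mem_image, ← hS]
  constructor
  · rintro ⟨h1, h2⟩
    have h3 : emb S (coeffs S u) = u := proj_of_mem_supported h1
    exact ⟨coeffs S u, by rwa [h3, proj_of_mem_supported h1], h3⟩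
  · rintro ⟨x, hx, rfl⟩
    rw [hpe] at hx
    exact ⟨emb_mem_supported S x, hx⟩

theorem mem_ball_iff {β r : ℝ} {e : ℕ ≃ PosMode} {n m : ℕ} {u : TrigPoly} :
    u ∈ ball β r (galerkin e n m) ↔
      u ∈ Finsupp.supported ℝ ℝ (modes e n m : Set Mode) ∧ normEβ β u ≤ r := by
  rw [ball, galerkin_eq]; rfl

theorem supported_modes_mono {e : ℕ ≃ PosMode} {n n' : ℕ} (h : n ≤ n') (m : ℕ) :
    Finsupp.supported ℝ ℝ (modes e n m : Set Mode) ≤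
      Finsupp.supported ℝ ℝ (modes e n' m : Set Mode) :=
  Finsupp.supported_mono (by exact_mod_cast modes_mono h m)

theorem eig_mem_supported (e : ℕ ≃ PosMode) (n m : ℕ) :
    eig e n ∈ Finsupp.supported ℝ ℝ (modes e (n + 1) m : Set Mode) :=
  Finsupp.single_mem_supported ℝ 1 (mem_modes_succ e n m)

theorem coeff_smul_eig_add {e : ℕ ≃ PosMode} {n m : ℕ} (t : ℝ) {v : TrigPoly}
    (hv : v ∈ Finsupp.supported ℝ ℝ (modes e n m : Set Mode)) :
    (t • eig e n + v) (e n).1 = t := by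
  rw [Finsupp.add_apply, (Finsupp.mem_supported' ℝ v).1 hv _ (notMem_modes e n m), eig]
  simp

theorem proj_smul_eig_add {e : ℕ ≃ PosMode} {n m : ℕ} (t : ℝ) {v : TrigPoly}
    (hv : v ∈ Finsupp.supported ℝ ℝ (modes e n m : Set Mode)) :
    proj (modes e n m) (t • eig e n + v) = v := by
  ext i
  by_cases h : i ∈ modes e n m
  · have hne : (e n).1 ≠ i := fun h' => notMem_modes e n m (h' ▸ h)
    rw [proj_apply_of_mem _ h, Finsupp.add_apply, eig, Finsupp.smul_apply,
      Finsupp.single_eq_of_ne hne.symm]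
    simp
  · rw [proj_apply_of_notMem _ h, (Finsupp.mem_supported' ℝ v).1 hv i h]

theorem quad_smul_eig_add {e : ℕ ≃ PosMode} {n m : ℕ} (W : Mode → ℝ) (t : ℝ) {v : TrigPoly}
    (hv : v ∈ Finsupp.supported ℝ ℝ (modes e n m : Set Mode)) :
    quad W (t • eig e n + v) = W (e n).1 * t ^ 2 + quad W v := by
  classical
  have h1 : t • eig e n + v ∈ Finsupp.supported ℝ ℝ (modes e (n + 1) m : Set Mode) :=
    add_mem (Submodule.smul_mem _ _ (eig_mem_supported e n m))
      (supported_modes_mono n.le_succ m hv)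
  rw [quad_eq_sum W h1, modes_succ, Finset.sum_insert (notMem_modes e n m),
    coeff_smul_eig_add t hv, quad_eq_sum W hv]
  congr 1
  refine Finset.sum_congr rfl fun i hi => ?_
  rw [← proj_apply_of_mem (t • eig e n + v) hi, proj_smul_eig_add t hv]

theorem mem_setU {e : ℕ ≃ PosMode} {R : ℕ → ℝ} {β : ℝ} {n m : ℕ} {u : TrigPoly}
    (hu : u ∈ setU e R β n m) :
    ∃ (t : ℝ) (v : TrigPoly), 0 ≤ t ∧ v ∈ Finsupp.supported ℝ ℝ (modes e n m : Set Mode) ∧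
      u = t • eig e n + v ∧ normEβ β u ≤ R (n + 1) ∧
      u ∈ Finsupp.supported ℝ ℝ (modes e (n + 1) m : Set Mode) := by
  obtain ⟨t, ht, v, hv, rfl, hu⟩ := hu
  have hv := (mem_ball_iff.1 hv).1
  exact ⟨t, v, ht.1, hv, rfl, hu, add_mem (Submodule.smul_mem _ _ (eig_mem_supported e n m))
    (supported_modes_mono n.le_succ m hv)⟩

theorem ball_subset_setU {e : ℕ ≃ PosMode} {R : ℕ → ℝ} (hR : ∀ n, 0 < R n) (β : ℝ) (n m : ℕ) :
    ball β (R (n + 1)) (galerkin e n m) ⊆ setU e R β n m := fun u hu =>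
  ⟨0, ⟨le_rfl, (hR _).le⟩, u, hu, by simp, hu.2⟩

theorem setD_subset_setU {e : ℕ ≃ PosMode} {R : ℕ → ℝ} (hR : ∀ n, 0 < R n)
    (hR4 : ∀ n, 4 * R n < R (n + 1)) (β : ℝ) (n m : ℕ) :
    setD e R β n m ⊆ setU e R β n m := fun u hu =>
  ball_subset_setU hR β n m ⟨hu.1, hu.2.trans (by linarith [hR n, hR4 n])⟩

theorem id_mem_classΓ (e : ℕ ≃ PosMode) (R : ℕ → ℝ) (β : ℝ) {n m : ℕ} (h : n ≤ m) :
    (fun u => u) ∈ classΓ e R β n m := by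
  refine ⟨continuousOn_id, fun u hu => ?_, fun _ _ => rfl, fun _ _ _ => rfl⟩
  rw [galerkin_eq]
  exact supported_modes_mono h m (mem_ball_iff.1 hu).1

theorem id_mem_classΛ (e : ℕ ≃ PosMode) (R : ℕ → ℝ) (β : ℝ) {n m : ℕ} (h : n < m) :
    (fun u => u) ∈ classΛ e R β n m := by
  refine ⟨continuousOn_id, fun u hu => ?_, id_mem_classΓ e R β h.le, fun _ _ _ => rfl,
    fun _ _ => rfl⟩
  rw [galerkin_eq]
  obtain ⟨t, v, -, -, -, -, hu⟩ := mem_setU hu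
  exact supported_modes_mono h m hu

/-! ### Extension of maps from `D` to `U` -/

/-- A map in `Γ` whose values can be deformed into the next Galerkin space extends to a map in
`Λ` whose values lie either on the track of the deformation or in that space. -/
theorem exists_extension_classΛ {e : ℕ ≃ PosMode} {R : ℕ → ℝ} (hR : ∀ n, 0 < R n)
    (hR4 : ∀ n, 4 * R n < R (n + 1)) {β : ℝ} (hβ : 0 < β) {n m : ℕ} (hnm : n < m)
    {h : TrigPoly → TrigPoly} (hh : h ∈ classΓ e R β n m)
    {G : ℝ × setD e R β n m → TrigPoly} (hG : Continuous G) (hG0 : ∀ x, G (0, x) = h x)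
    (hG1 : ∀ x, G (1, x) ∈ Finsupp.supported ℝ ℝ (modes e (n + 1) m : Set Mode))
    (hGF : ∀ z, G z ∈ Finsupp.supported ℝ ℝ (modes e m m : Set Mode))
    (hGP : ∀ x : setD e R β n m,
      h x ∈ Finsupp.supported ℝ ℝ (modes e (n + 1) m : Set Mode) →
      ∀ r, G (r, x) ∈ Finsupp.supported ℝ ℝ (modes e (n + 1) m : Set Mode)) :
    ∃ H ∈ classΛ e R β n m, EqOn H h (setD e R β n m) ∧ ∀ u ∈ setU e R β n m,
      H u ∈ range G ∨ H u ∈ Finsupp.supported ℝ ℝ (modes e (n + 1) m : Set Mode) := by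
  set X := Finsupp.supported ℝ ℝ (modes e n m : Set Mode)
  set P := Finsupp.supported ℝ ℝ (modes e (n + 1) m : Set Mode)
  set F := Finsupp.supported ℝ ℝ (modes e m m : Set Mode)
  have hXP : X ≤ P := supported_modes_mono n.le_succ m
  have hPF : P ≤ F := supported_modes_mono hnm m
  have hr := hR n
  have hrr := hR4 n
  set r := R n
  set r' := R (n + 1)
  set w := waveWeight β (e n).1
  have hw : 0 < w := waveWeight_pos (e n).2
  have hw' : |w| = w := abs_of_pos hw
  set N := fun u => normEβ β (proj (modes e (n + 1) m) u)
  have hN : Continuous N := continuous_normEβ_proj hβ _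
  set pr := fun u => proj (modes e n m) u
  have hpr : Continuous pr := continuous_proj _
  have hprX : ∀ u, pr u ∈ X := proj_mem_supported _
  have hretX : ∀ u, retract β r (pr u) ∈ X := fun u => Submodule.smul_mem _ _ (hprX u)
  have hretD : ∀ u, retract β r (pr u) ∈ setD e R β n m := fun u =>
    mem_ball_iff.2 ⟨hretX u, normEβ_retract_le hβ hr _⟩
  -- The coefficient of `e_{n+1}` serves as time. The deformation ends at `t = r / √w`, where `t
  -- e_{n+1}` has norm `r`.
  set Gt := fun u : TrigPoly =>
    G (clamp (u (e n).1 / (r / Real.sqrt w)), ⟨retract β r (pr u), hretD u⟩)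
  have hGt : Continuous Gt := by
    refine hG.comp ((continuous_clamp.comp ((continuous_coeff _).div_const _)).prodMk ?_)
    exact (continuous_retract_proj hβ hr _).subtype_mk _
  -- On the cylinder where both components have norm at most `r`, the squared norm is at most `2 * r
  -- ^ 2` and `σ = 0`; on the outer sphere `σ = 1` and `H` is the identity. The growth of `R` makes
  -- the denominator positive.
  set σ := fun u => clamp ((N u ^ 2 - 2 * r ^ 2) / (r' ^ 2 - 2 * r ^ 2))
  have hden : 0 < r' ^ 2 - 2 * r ^ 2 := by nlinarith
  have hσ : Continuous σ := continuous_clamp.comp (((hN.pow 2).sub continuous_const).div_const _)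
  -- The term `pr u - retract β r (pr u)` restores what the retraction removed, so that `H` is the
  -- identity on `X` outside the smaller ball.
  set H := fun u => Gt u + (pr u - retract β r (pr u)) +
    σ u • (u - Gt u - (pr u - retract β r (pr u))) with hH
  have hHcont : Continuous H := by
    have := continuous_retract_proj hβ hr (modes e n m)
    have h1 : Continuous fun u => pr u - retract β r (pr u) := hpr.sub this
    exact (hGt.add h1).add (hσ.smul ((continuous_id.sub hGt).sub h1))
  have hNu : ∀ u ∈ P, N u = normEβ β u := fun u hu => by
    simp only [N]; rw [proj_of_mem_supported hu]
  have hσ0 : ∀ u ∈ P, normEβ β u ^ 2 ≤ 2 * r ^ 2 → σ u = 0 := fun u hu h => by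
    simp only [σ]
    rw [hNu u hu]
    exact clamp_of_nonpos (div_nonpos_of_nonpos_of_nonneg (by linarith) hden.le)
  have hprX' : ∀ u ∈ X, pr u = u := fun u hu => proj_of_mem_supported hu
  have hcX : ∀ u ∈ X, u (e n).1 = 0 := fun u hu =>
    (Finsupp.mem_supported' ℝ u).1 hu _ (notMem_modes e n m)
  have hGtX : ∀ u ∈ X, Gt u = h (retract β r u) := fun u hu => by
    simp only [Gt]
    rw [hcX u hu, zero_div, clamp_of_nonpos le_rfl, hG0]
    simp only
    rw [hprX' u hu]
  have hHD : EqOn H h (setD e R β n m) := by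
    intro u hu
    obtain ⟨huX, hur⟩ := mem_ball_iff.1 hu
    have h1 : σ u = 0 := hσ0 u (hXP huX) (by nlinarith [normEβ_nonneg β u])
    simp only [hH]
    rw [h1, zero_smul, add_zero, hGtX u huX, hprX' u huX, retract_of_le hr hur, sub_self, add_zero]
  have hHF : ∀ u ∈ setU e R β n m, H u ∈ F := by
    intro u hu
    obtain ⟨t, v, -, -, -, -, huP⟩ := mem_setU hu
    have h1 := hPF (hXP (sub_mem (hprX u) (hretX u)))
    exact add_mem (add_mem (hGF _) h1)
      (Submodule.smul_mem _ _ (sub_mem (sub_mem (hPF huP) (hGF _)) h1))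
  have hHP : ∀ u ∈ P, Gt u ∈ P → H u ∈ P := fun u huP hGu => by
    have h1 := hXP (sub_mem (hprX u) (hretX u))
    exact add_mem (add_mem hGu h1) (Submodule.smul_mem _ _ (sub_mem (sub_mem huP hGu) h1))
  have hDU := setD_subset_setU (e := e) hR hR4 β n m
  refine ⟨H, ⟨hHcont.continuousOn, fun u hu => ?_, ⟨hHcont.continuousOn, fun u hu => ?_,
    fun u hu => ?_, fun u hu hur => ?_⟩, fun u hu hur => ?_, fun u hu => ?_⟩, hHD, fun u hu => ?_⟩
  · rw [galerkin_eq]; exact hHF u hu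
  · rw [galerkin_eq]; exact hHF u (hDU hu)
  · have hneg : -u ∈ setD e R β n m :=
      mem_ball_iff.2 ⟨neg_mem (mem_ball_iff.1 hu).1, by rw [normEβ_neg hβ]; exact hu.2⟩
    rw [hHD hu, hHD hneg, hh.2.2.1 u hu]
  · rw [hHD hu, hh.2.2.2 u hu hur]
  · obtain ⟨t, v, -, -, -, -, huP⟩ := mem_setU hu
    have h1 : σ u = 1 := by
      simp only [σ]
      rw [hNu u huP, hur, div_self hden.ne', clamp_of_one_le le_rfl]
    simp only [hH]
    rw [h1, one_smul]; abel
  · obtain ⟨hu1, hu2⟩ := hu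
    have huX := (mem_ball_iff.1 hu1).1
    have hur : r < normEβ β u := by
      by_contra! hcon
      exact hu2 (mem_ball_iff.2 ⟨huX, hcon⟩)
    have h1 : retract β r u ∈ setD e R β n m :=
      mem_ball_iff.2 ⟨Submodule.smul_mem _ _ huX, normEβ_retract_le hβ hr u⟩
    have h2 := hh.2.2.2 _ h1 (normEβ_retract_of_le hβ hr hur.le)
    simp only [hH]
    rw [hGtX u huX, h2, hprX' u huX]
    have h3 : u - retract β r u - (u - retract β r u) = 0 := sub_self _
    rw [h3, smul_zero]; abel
  · obtain ⟨t, v, ht0, hv, hut, hur, huP⟩ := mem_setU hu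
    have hpru : pr u = v := by simp only [pr]; rw [hut]; exact proj_smul_eig_add t hv
    have hcu : u (e n).1 = t := by rw [hut]; exact coeff_smul_eig_add t hv
    -- Inside the cylinder `H` follows the track of `G`. Above it the deformation has ended in `P`;
    -- beside it `h` is the identity at the retracted point, so the track never leaves `P`. In the
    -- last two cases interpolation stays in the linear space `P`.
    rcases le_or_gt (normEβ β v) r with hvr | hvr
    · rcases le_total t (r / Real.sqrt w) with htt | htt
      · left
        have h1 : normEβ β u ^ 2 ≤ 2 * r ^ 2 := by
          have h2 : t * Real.sqrt w ≤ r := (le_div_iff₀ (Real.sqrt_pos.2 hw)).1 htt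
          have h3 : (t * Real.sqrt w) ^ 2 ≤ r ^ 2 := pow_le_pow_left₀ (by positivity) h2 2
          rw [mul_pow, Real.sq_sqrt hw.le] at h3
          have h4 := pow_le_pow_left₀ (normEβ_nonneg β v) hvr 2
          rw [normEβ_sq hβ] at h4 ⊢
          rw [hut, quad_smul_eig_add _ t hv]
          change |w| * t ^ 2 + _ ≤ _
          rw [hw']
          linarith
        have h5 : H u = Gt u := by
          simp only [hH]
          rw [hσ0 u huP h1, hpru, retract_of_le hr hvr, sub_self, zero_smul, add_zero, add_zero]
        rw [h5]
        exact mem_range_self _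
      · right
        refine hHP u huP ?_
        simp only [Gt]
        rw [hcu, clamp_of_one_le ((one_le_div (div_pos hr (Real.sqrt_pos.2 hw))).2 htt)]
        exact hG1 _
    · right
      refine hHP u huP (hGP _ ?_ _)
      have h1 : normEβ β (retract β r (pr u)) = r := by
        rw [hpru]; exact normEβ_retract_of_le hβ hr hvr.le
      rw [hh.2.2.2 _ (hretD u) h1]
      exact hXP (hretX u)

/-! ### The minimax values -/

theorem functionalJ_zero {s : ℝ} (hs : 1 < s) {f : ℝ × ℝ → ℝ} (hf : ContinuousOn f Q)
    (χ : ℝ → ℝ) (a₆ β : ℝ) : functionalJ s f χ a₆ β 0 = 0 := by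
  have h1 : powInt s 0 = 0 := by
    have := powInt_smul s le_rfl (0 : TrigPoly)
    rwa [zero_smul, Real.zero_rpow (by linarith), zero_mul] at this
  have h2 : forcing f 0 = 0 := by
    have := forcing_smul f 0 (0 : TrigPoly)
    rwa [zero_smul, zero_mul] at this
  rw [functionalJ_eq hs hf, quad_zero, h1, h2]; ring

/-- One of `u` and `-u` has nonpositive forcing integral, and at that sign the forcing term only
raises `J`. The cut-off need not be even; its nonnegativity suffices. -/
theorem quad_le_of_functionalJ_le {s : ℝ} (hs : 1 < s) {f : ℝ × ℝ → ℝ} (hf : ContinuousOn f Q)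
    {χ : ℝ → ℝ} (hχ : IsCutoff χ) {a₆ β C : ℝ} {u : TrigPoly}
    (h : functionalJ s f χ a₆ β u ≤ C) (h' : functionalJ s f χ a₆ β (-u) ≤ C) :
    1 / 2 * quad (waveWeight β) u ≤ powInt s u + C := by
  rw [functionalJ_eq hs hf] at h h'
  rw [quad_neg, powInt_neg, forcing_neg] at h'
  have h1 : 0 ≤ cutoffψ s f χ a₆ β u := hχ.nonneg _
  have h2 : 0 ≤ cutoffψ s f χ a₆ β (-u) := hχ.nonneg _
  rcases le_total 0 (forcing f u) with hL | hL
  · nlinarith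
  · nlinarith

/-- An odd map fixes `0`, so every competitor attains the value `J 0 = 0`. This keeps the extended
real `b_n^m` from being `⊥`. -/
theorem minimaxB_nonneg {J : TrigPoly → ℝ} (hJ : J 0 = 0) (e : ℕ ≃ PosMode) {R : ℕ → ℝ}
    (hR : ∀ n, 0 < R n) {β : ℝ} (hβ : 0 < β) (n m : ℕ) : 0 ≤ minimaxB J e R β n m := by
  refine le_iInf₂ fun h hh => ?_
  have h0 : (0 : TrigPoly) ∈ setD e R β n m :=
    mem_ball_iff.2 ⟨zero_mem _, by rw [normEβ_zero hβ]; exact (hR n).le⟩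
  have h1 : h 0 = 0 := by
    have h2 := hh.2.2.1 0 h0
    rw [neg_zero] at h2
    ext i
    have h3 := DFunLike.congr_fun h2 i
    rw [Finsupp.neg_apply] at h3
    rw [Finsupp.zero_apply]
    linarith
  refine le_iSup₂_of_le 0 h0 ?_
  rw [h1, hJ]
  exact le_rfl

end WaveMinimax

/-! ### Assembly of the proof. -/

theorem mainTheorem2 (s : ℝ) (hs : 1 < s)
    (f : ℝ × ℝ → ℝ) (hf : ContDiffOn ℝ 2 f Q)
    (hf0 : ∀ t ∈ Set.Icc 0 (2 * Real.pi), f (0, t) = 0 ∧ f (Real.pi, t) = 0)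
    (e : ℕ ≃ PosMode) (he : Monotone fun l => (e l).1.eigenvalue) :
    ∃ C : ℕ → ℝ,
      ∀ (χ : ℝ → ℝ), IsCutoff χ →
      ∀ (a₆ : ℝ), 0 < a₆ →
      ∀ (R : ℕ → ℝ), (∀ n, 0 < R n) → (∀ n, 4 * R n < R (n + 1)) →
      ∀ (n m : ℕ), n < m →
      ∀ (β : ℝ), 0 < β →
      ∀ (δ : ℝ), 0 < δ →
        (δ : EReal) < minimaxC (functionalJ s f χ a₆ β) e R β n m
            - minimaxB (functionalJ s f χ a₆ β) e R β n m →
        (∃ H ∈ classΛδ (functionalJ s f χ a₆ β) e R β n m δ,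
          ∀ u ∈ setU e R β n m, functionalJ s f χ a₆ β (H u) ≤ C (n + 1)) ∧
        minimaxCδ (functionalJ s f χ a₆ β) e R β n m δ ≤ (C (n + 1) : EReal) := by
  have hfc : ContinuousOn f Q := hf.continuousOn
  choose C C' hC0 hCC' hdef using fun n => exists_deformation hs hfc he n
  -- The constant is requested at index `n + 1`, whereas `exists_deformation` is indexed by `n`.
  refine ⟨fun k => C' (k - 1), fun χ hχ a₆ ha₆ R hR hR4 n m hnm β hβ δ hδ hlt => ?_⟩
  simp only [Nat.add_sub_cancel]
  obtain ⟨hJP, hdef⟩ := hdef n χ hχ a₆ ha₆ β hβ m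
  set J := functionalJ s f χ a₆ β
  have hb0 : 0 ≤ minimaxB J e R β n m := minimaxB_nonneg (functionalJ_zero hs hfc χ a₆ β) e hR hβ n m
  have hbC : minimaxB J e R β n m ≤ (C n : EReal) :=
    iInf₂_le_of_le _ (id_mem_classΓ e R β hnm.le) (iSup₂_le fun u hu =>
      EReal.coe_le_coe_iff.2 (hJP u (supported_modes_mono n.le_succ m (mem_ball_iff.1 hu).1)))
  have hcC : minimaxC J e R β n m ≤ (C n : EReal) :=
    iInf₂_le_of_le _ (id_mem_classΛ e R β hnm) (iSup₂_le fun u hu => by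
      obtain ⟨t, v, -, -, -, -, huP⟩ := mem_setU hu
      exact EReal.coe_le_coe_iff.2 (hJP u huP))
  obtain ⟨b, hb⟩ : ∃ b : ℝ, minimaxB J e R β n m = b :=
    ⟨_, (EReal.coe_toReal (hbC.trans_lt (EReal.coe_lt_top _)).ne
      ((EReal.bot_lt_coe 0).trans_le hb0).ne').symm⟩
  -- The upper bound on `δ` enters only here: it places the prescribed level on `D_n^m` below the
  -- universal constant.
  have hbδC : b + δ ≤ C n := by
    have h1 : (δ : EReal) < ((C n - b : ℝ) : EReal) := by
      rw [EReal.coe_sub, ← hb]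
      exact hlt.trans_le (EReal.sub_le_sub hcC le_rfl)
    linarith [EReal.coe_lt_coe_iff.1 h1]
  have hblt : minimaxB J e R β n m < ((b + δ : ℝ) : EReal) := by
    rw [hb]; exact EReal.coe_lt_coe_iff.2 (by linarith)
  obtain ⟨h, hh, hJh⟩ : ∃ h ∈ classΓ e R β n m,
      ⨆ u ∈ setD e R β n m, (J (h u) : EReal) < ((b + δ : ℝ) : EReal) := by
    simpa only [minimaxB, iInf_lt_iff, exists_prop] using hblt
  have hJhD : ∀ u ∈ setD e R β n m, J (h u) ≤ b + δ := fun u hu =>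
    EReal.coe_le_coe_iff.1 ((le_iSup₂ (f := fun u _ => (J (h u) : EReal)) u hu).trans hJh.le)
  have hJhC : ∀ u ∈ setD e R β n m, J (h u) ≤ C n := fun u hu => (hJhD u hu).trans hbδC
  have : CompactSpace (setD e R β n m) :=
    isCompact_iff_compactSpace.1 (isCompact_ball hβ (R n) e n m)
  have hι : Topology.IsClosedEmbedding
      fun x : setD e R β n m => coeffs (modes e n m) (x : TrigPoly) := by
    refine Continuous.isClosedEmbedding ((continuous_coeffs _).comp continuous_subtype_val)
      fun x y hxy => Subtype.ext ?_
    rw [← proj_of_mem_supported (mem_ball_iff.1 x.2).1,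
      ← proj_of_mem_supported (mem_ball_iff.1 y.2).1]
    exact congrArg (emb _) hxy
  obtain ⟨G, hG, hG0, hG1, hGF, hGJ, hGP⟩ := hdef (modes e m m) (modes_mono hnm m) _ _ hι
    (fun x => h x) (continuousOn_iff_continuous_domRestrict.1 hh.1)
    (fun x => by rw [← galerkin_eq]; exact hh.2.1 x.2)
    -- Oddness of `h` and symmetry of `D_n^m` bound `J` at `-h x`, which is the value of `h` at
    -- `-x`.
    (fun x => quad_le_of_functionalJ_le hs hfc hχ (hJhC x x.2) (by
      have hneg : -(x : TrigPoly) ∈ setD e R β n m :=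
        mem_ball_iff.2 ⟨neg_mem (mem_ball_iff.1 x.2).1, by rw [normEβ_neg hβ]; exact x.2.2⟩
      rw [← hh.2.2.1 x x.2]
      exact hJhC _ hneg))
    (fun x => hJhC x x.2)
  obtain ⟨H, hHΛ, hHD, hHU⟩ :=
    exists_extension_classΛ hR hR4 hβ hnm hh hG hG0 hG1 hGF hGP
  have hmem : H ∈ classΛδ J e R β n m δ := by
    refine ⟨hHΛ, fun u hu => ?_⟩
    rw [hHD hu, hb, ← EReal.coe_add]
    exact EReal.coe_le_coe_iff.2 (hJhD u hu)
  have hbound : ∀ u ∈ setU e R β n m, J (H u) ≤ C' n := fun u hu => by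
    rcases hHU u hu with ⟨z, hz⟩ | hP
    · rw [← hz]; exact hGJ z
    · exact (hJP _ hP).trans (hCC' n)
  exact ⟨⟨H, hmem, hbound⟩, iInf₂_le_of_le H hmem (iSup₂_le fun u hu =>
    EReal.coe_le_coe_iff.2 (hbound u hu))⟩
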